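/- All Hilbert spaces are complex and finite-dimensional, $\mathcal B(\mathcal H)$ denotes the linear operators on $\mathcal H$, $\mathcal C(\mathcal H,\mathcal K)$ the set of completely positive trace preserving maps $\mathcal B(\mathcal H)\to\mathcal B(\mathcal K)$, and $\log$ is the logarithm to base two. An \emph{arbitrarily varying quantum channel} (AVQC) is given by a non-empty, finite or infinite, family $\mathfrak I=\{\mathcal N_s\}_{s\in\mathbf S}\subset\mathcal C(\mathcal H,\mathcal K)$; for $s^l=(s_1,\dots,s_l)\in\mathbf S^l$ put $\mathcal N_{s^l}:=\mathcal N_{s_1}\otimes\cdots\otimes\mathcal N_{s_l}$. For a non-zero subspace $\mathcal F\subset\mathcal F'$ let $\pi_{\mathcal F}$ be the maximally mixed state on $\mathcal F$, and for a completely positive map $\Lambda:\mathcal B(\mathcal F)\to\mathcal B(\mathcal F')$ let $F_e(\pi_{\mathcal F},\Lambda)=\langle\psi,(\mathrm{id}\otimes\Lambda)(|\psi\rangle\langle\psi|)\psi\rangle$, with $\psi\in\mathcal F\otimes\mathcal F$ a purification of $\pi_{\mathcal F}$, be the entanglement fidelity. Let $F(\rho,\sigma)=\|\sqrt\rho\sqrt\sigma\|_1^2$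 be the fidelity. An $(l,k_l)$ \emph{random entanglement transmission code} for $\mathfrak I$ consists of spaces $\mathcal F_l\subset\mathcal F_l'$ with $\dim\mathcal F_l=k_l\ge1$ and a probability measure $\mu_l$ on $\mathcal C(\mathcal F_l,\mathcal H^{\otimes l})\times\mathcal C(\mathcal K^{\otimes l},\mathcal F_l')$ with respect to a sigma-algebra $\sigma_l$ that contains all singletons and for which $(\mathcal P,\mathcal R)\mapsto F_e(\pi_{\mathcal F_l},\mathcal R\circ\mathcal N_{s^l}\circ\mathcal P)$ is measurable for every $s^l\in\mathbf S^l$. It is an $(l,k_l)$ \emph{random strong subspace transmission code} if, moreover, $(\mathcal P,\mathcal R)\mapsto F(|\psi\rangle\langle\psi|,\mathcal R\circ\mathcal N_{s^l}\circ\mathcal P(|\psi\rangle\langle\psi|))$ is measurable for every $s^l\in\mathbf S^l$ and every unit vector $\psi\in\mathcal F_l$. A code is \emph{deterministic} if $\mu_l$ is a point measure, i.e. $\mu_l(\{(\mathcal P^l,\mathcal R^l)\})=1$ for some pair $(\mathcal P^l,\mathcal R^l)$ and $\mu_l(A)=0$ for every $A\in\sigma_l$ that does not contain it. A number $R\ge0$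 is an \emph{achievable entanglement transmission rate} for $\mathfrak I$ with random codes if there is a sequence of $(l,k_l)$ random entanglement transmission codes, $l\in\mathbb N$, with $\liminf_{l\to\infty}\frac1l\log k_l\ge R$ and $$\lim_{l\to\infty}\ \inf_{s^l\in\mathbf S^l}\int F_e(\pi_{\mathcal F_l},\mathcal R^l\circ\mathcal N_{s^l}\circ\mathcal P^l)\,d\mu_l(\mathcal P^l,\mathcal R^l)=1 .$$ It is an \emph{achievable strong subspace transmission rate} for $\mathfrak I$ with random codes if there is a sequence of $(l,k_l)$ random strong subspace transmission codes with $\liminf_{l\to\infty}\frac1l\log k_l\ge R$ and $$\lim_{l\to\infty}\ \inf_{s^l\in\mathbf S^l}\ \min_{\psi\in\mathcal F_l,\ \|\psi\|=1}\int F\big(|\psi\rangle\langle\psi|,\mathcal R^l\circ\mathcal N_{s^l}\circ\mathcal P^l(|\psi\rangle\langle\psi|)\big)\,d\mu_l(\mathcal P^l,\mathcal R^l)=1 .$$ The rates are \emph{deterministically achievable} if the codes can be chosen deterministic. Let $\mathcal A_{\mathrm{random}}(\mathfrak I)$ and $\mathcal A_{\mathrm{det}}(\mathfrak I)$ be the suprema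 of the achievable and of the deterministically achievable entanglement transmission rates, and $\mathcal A_{\mathrm{s,random}}(\mathfrak I)$ and $\mathcal A_{\mathrm{s,det}}(\mathfrak I)$ those of the strong subspace transmission rates. \textbf{Theorem.} For every AVQC $\mathfrak I=\{\mathcal N_s\}_{s\in\mathbf S}$, $$\mathcal A_{\mathrm{s,random}}(\mathfrak I)=\mathcal A_{\mathrm{random}}(\mathfrak I),\qquad \mathcal A_{\mathrm{s,det}}(\mathfrak I)=\mathcal A_{\mathrm{det}}(\mathfrak I).$$ -/

import Mathlib

/-!
Hilbert spaces are written in orthonormal coordinates: a finite index type `a` stands for the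
space `ℂ^a`, operators on it are matrices `Matrix a a ℂ`, the tensor product of `ℂ^r` and `ℂ^a`
has index type `r × a`, and the `l`-th tensor power of `ℂ^a` has index type `Fin l → a`.
-/

namespace AVQC

open scoped ENNReal NNReal MeasureTheory Matrix MatrixOrder ComplexOrder

section Channels

open scoped Matrix.Norms.L2Operator

/-- Completely positive trace preserving maps from operators on `ℂ^a` to operators on `ℂ^b`. -/
structure Channel (a b : Type*) [Fintype a] [DecidableEq a] [Fintype b] [DecidableEq b] extends
    CompletelyPositiveMap (Matrix a a ℂ) (Matrix b b ℂ) where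
  trace_preserving : ∀ X : Matrix a a ℂ, (toLinearMap X).trace = X.trace

/-- The linear map underlying a channel. -/
def Channel.lin {a b : Type*} [Fintype a] [DecidableEq a] [Fintype b] [DecidableEq b]
    (Φ : Channel a b) : Matrix a a ℂ →ₗ[ℂ] Matrix b b ℂ :=
  Φ.toLinearMap

end Channels

/-- The tensor product `Φ 0 ⊗ ⋯ ⊗ Φ (l - 1)` of linear maps on operator spaces, given on the
matrix units `E_{x x'} = ⨂ i, E_{x i, x' i}` and extended linearly. -/
def tensorMap {a b : Type*} [Fintype a] [DecidableEq a] {l : ℕ}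
    (Φ : Fin l → (Matrix a a ℂ →ₗ[ℂ] Matrix b b ℂ)) :
    Matrix (Fin l → a) (Fin l → a) ℂ →ₗ[ℂ] Matrix (Fin l → b) (Fin l → b) ℂ where
  toFun X := Matrix.of fun y y' => ∑ x, ∑ x', X x x' *
    ∏ i, Φ i (Matrix.single (x i) (x' i) 1) (y i) (y' i)
  map_add' X Y := by
    ext y y'
    simp [add_mul, Finset.sum_add_distrib]
  map_smul' c X := by
    ext y y'
    simp [Finset.mul_sum, mul_assoc]

/-- `tensorMap` acts on product operators factor by factor. -/
theorem tensorMap_product {a b : Type*} [Fintype a] [DecidableEq a] {l : ℕ}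
    (Φ : Fin l → (Matrix a a ℂ →ₗ[ℂ] Matrix b b ℂ)) (A : Fin l → Matrix a a ℂ) :
    tensorMap Φ (Matrix.of fun x x' => ∏ i, A i (x i) (x' i)) =
      Matrix.of fun y y' => ∏ i, Φ i (A i) (y i) (y' i) := by
  have key : ∀ i (u v : b), Φ i (A i) u v =
      ∑ p : a × a, A i p.1 p.2 * Φ i (Matrix.single p.1 p.2 1) u v := by
    intro i u v
    conv_lhs => rw [Matrix.matrix_eq_sum_single (A i)]
    simp only [map_sum, Matrix.sum_apply, Fintype.sum_prod_type]
    refine Finset.sum_congr rfl fun p _ => Finset.sum_congr rfl fun q _ => ?_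
    rw [show Matrix.single p q (A i p q) = A i p q • Matrix.single p q (1 : ℂ) by
      simp [Matrix.smul_single], map_smul]
    simp
  ext y y'
  simp only [tensorMap, LinearMap.coe_mk, AddHom.coe_mk, Matrix.of_apply, key,
    ← Finset.prod_mul_distrib]
  rw [Fintype.prod_sum (fun i (p : a × a) =>
    A i p.1 p.2 * Φ i (Matrix.single p.1 p.2 1) (y i) (y' i)), ← Fintype.sum_prod_type']
  exact Fintype.sum_equiv (Equiv.arrowProdEquivProdArrow (Fin l) (fun _ => a) (fun _ => a)).symm _ _
    fun _ => rfl

/-- The channel `N_{s^l} = N_{s_1} ⊗ ⋯ ⊗ N_{s_l}` of the AVQC generated by `N`. -/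
def blockMap {S a b : Type*} [Fintype a] [DecidableEq a] [Fintype b] [DecidableEq b]
    (N : S → Channel a b) {l : ℕ} (s : Fin l → S) :
    Matrix (Fin l → a) (Fin l → a) ℂ →ₗ[ℂ] Matrix (Fin l → b) (Fin l → b) ℂ :=
  tensorMap fun i => (N (s i)).lin

/-- The rank-one operator `|v⟩⟨v|`. -/
def proj {n : Type*} (v : n → ℂ) : Matrix n n ℂ := Matrix.vecMulVec v (star v)

/-- The map `id ⊗ Λ` on operators on `ℂ^r ⊗ ℂ^m`. -/
def idTensor (r : Type*) {m n : Type*} (Λ : Matrix m m ℂ →ₗ[ℂ] Matrix n n ℂ)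
    (X : Matrix (r × m) (r × m) ℂ) : Matrix (r × n) (r × n) ℂ :=
  Matrix.of fun p q => Λ (Matrix.of fun i j => X (p.1, i) (q.1, j)) p.2 q.2

/-- The unit vector `k^{-1/2} ∑ i, e_i ⊗ e_i` of `ℂ^k ⊗ ℂ^k`. -/
noncomputable def maxEntangled (k : ℕ) : Fin k × Fin k → ℂ :=
  fun p => if p.1 = p.2 then ((Real.sqrt k)⁻¹ : ℝ) else 0

/-- `maxEntangled k` is a purification of the maximally mixed state on `ℂ^k`. -/
theorem maxEntangled_purifies (k : ℕ) :
    (Matrix.of fun j j' => ∑ i, proj (maxEntangled k) (i, j) (i, j') :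
      Matrix (Fin k) (Fin k) ℂ) = (k : ℂ)⁻¹ • 1 := by
  ext j j'
  have h : ((Real.sqrt k : ℝ) : ℂ)⁻¹ * ((Real.sqrt k : ℝ) : ℂ)⁻¹ = (k : ℂ)⁻¹ := by
    rw [← mul_inv, ← Complex.ofReal_mul, Real.mul_self_sqrt (Nat.cast_nonneg k)]
    simp
  by_cases hj : j = j'
  · subst hj
    simp [proj, Matrix.vecMulVec_apply, maxEntangled, h]
  · simp [proj, Matrix.vecMulVec_apply, maxEntangled, hj]

/-- The entanglement fidelity `F_e(π_F, Λ) = ⟨ψ, (id ⊗ Λ)(|ψ⟩⟨ψ|) ψ⟩`, where `F ≅ ℂ^k` is embedded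
into `F' = ℂ^d` by the isometry `J`, the map `Λ` sends operators on `F` to operators on `F'`, and
`ψ` is a purification of the maximally mixed state `π_F`, seen in `F ⊗ F'` on the outside. -/
noncomputable def entanglementFidelity {k d : ℕ} (J : Matrix (Fin d) (Fin k) ℂ)
    (Λ : Matrix (Fin k) (Fin k) ℂ →ₗ[ℂ] Matrix (Fin d) (Fin d) ℂ) : ℝ :=
  let φ : Fin k × Fin d → ℂ := fun p => (J *ᵥ fun j => maxEntangled k (p.1, j)) p.2
  (star φ ⬝ᵥ (idTensor (Fin k) Λ (proj (maxEntangled k)) *ᵥ φ)).re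

/-- The trace norm `‖A‖₁ = tr |A|`. -/
noncomputable def traceNorm {n : Type*} [Fintype n] [DecidableEq n] (A : Matrix n n ℂ) : ℝ :=
  (CFC.abs A).trace.re

/-- The fidelity `F(ρ, σ) = ‖√ρ √σ‖₁²`. -/
noncomputable def fidelity {n : Type*} [Fintype n] [DecidableEq n] (ρ σ : Matrix n n ℂ) : ℝ :=
  traceNorm (CFC.sqrt ρ * CFC.sqrt σ) ^ 2

/-- The fidelity `F(|ψ⟩⟨ψ|, Λ(|ψ⟩⟨ψ|))` for a vector `ψ` of `F ≅ ℂ^k`, where `F` is embedded into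
`F' = ℂ^d` by the isometry `J`. -/
noncomputable def vectorFidelity {k d : ℕ} (J : Matrix (Fin d) (Fin k) ℂ)
    (Λ : Matrix (Fin k) (Fin k) ℂ →ₗ[ℂ] Matrix (Fin d) (Fin d) ℂ) (ψ : Fin k → ℂ) : ℝ :=
  fidelity (proj (J *ᵥ ψ)) (Λ (proj ψ))

section Codes

variable {S a b : Type*} [Fintype a] [DecidableEq a] [Fintype b] [DecidableEq b]

/-- Encoder-decoder pairs of block length `l` for the code space `ℂ^k`, with decoders that take
values in the operators on `ℂ^d`. -/
abbrev CodePair (a b : Type*) [Fintype a] [DecidableEq a] [Fintype b] [DecidableEq b]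
    (l k d : ℕ) : Type _ :=
  Channel (Fin k) (Fin l → a) × Channel (Fin l → b) (Fin d)

/-- The map `R ∘ N_{s^l} ∘ P` for the encoder-decoder pair `c = (P, R)`. -/
def codeMap (N : S → Channel a b) {l k d : ℕ} (s : Fin l → S) (c : CodePair a b l k d) :
    Matrix (Fin k) (Fin k) ℂ →ₗ[ℂ] Matrix (Fin d) (Fin d) ℂ :=
  c.2.lin ∘ₗ blockMap N s ∘ₗ c.1.lin

/-- An `(l, k)` random entanglement transmission code for the AVQC generated by `N`. The nonzero
code space `F ≅ ℂ^k` is a subspace of `F' = ℂ^d` through the isometry `incl`, and `μ` is a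
probability measure on the encoder-decoder pairs with respect to some sigma-algebra `σ`. -/
structure EntCode (N : S → Channel a b) (l k : ℕ) where
  d : ℕ
  k_pos : 0 < k
  incl : Matrix (Fin d) (Fin k) ℂ
  incl_isometry : inclᴴ * incl = 1
  σ : MeasurableSpace (CodePair a b l k d)
  singleton_mem : ∀ c : CodePair a b l k d, MeasurableSet[σ] {c}
  measurable_entanglementFidelity : ∀ s : Fin l → S,
    Measurable[σ] fun c : CodePair a b l k d => entanglementFidelity incl (codeMap N s c)
  μ : @MeasureTheory.Measure (CodePair a b l k d) σ
  prob : MeasureTheory.IsProbabilityMeasure μ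

/-- An `(l, k)` random strong subspace transmission code: the same object as a random
entanglement transmission code, such that the fidelities which enter the strong subspace
criterion are measurable as well. -/
structure StrongCode (N : S → Channel a b) (l k : ℕ) extends EntCode N l k where
  measurable_vectorFidelity : ∀ (s : Fin l → S) (ψ : EuclideanSpace ℂ (Fin k)), ‖ψ‖ = 1 →
    Measurable[σ] fun c : CodePair a b l k d => vectorFidelity incl (codeMap N s c) ψ.ofLp

/-- `μ` is a point measure, that is, the code is deterministic. -/
def EntCode.IsDeterministic {N : S → Channel a b} {l k : ℕ} (C : EntCode N l k) : Prop :=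
  ∃ c : CodePair a b l k C.d, C.μ {c} = 1 ∧
    ∀ A : Set (CodePair a b l k C.d), MeasurableSet[C.σ] A → c ∉ A → C.μ A = 0

/-- `inf_{s^l} ∫ F_e(π_F, R ∘ N_{s^l} ∘ P) dμ(P, R)`. -/
noncomputable def EntCode.performance {N : S → Channel a b} {l k : ℕ} (C : EntCode N l k) : ℝ :=
  ⨅ s : Fin l → S, ∫ c, entanglementFidelity C.incl (codeMap N s c) ∂C.μ

/-- `inf_{s^l} min_ψ ∫ F(|ψ⟩⟨ψ|, R ∘ N_{s^l} ∘ P (|ψ⟩⟨ψ|)) dμ(P, R)`, where `ψ` runs over the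
unit vectors of the code space. -/
noncomputable def StrongCode.performance {N : S → Channel a b} {l k : ℕ} (C : StrongCode N l k) :
    ℝ :=
  ⨅ s : Fin l → S, ⨅ ψ : Metric.sphere (0 : EuclideanSpace ℂ (Fin k)) 1,
    ∫ c, vectorFidelity C.incl (codeMap N s c) ψ.1.ofLp ∂C.μ

/-- `liminf_{l → ∞} (1 / l) log₂ (k l) ≥ R`, the lower limit being taken in `[-∞, ∞]`. -/
def RateAtLeast (k : ℕ → ℕ) (R : ℝ≥0) : Prop :=
  ((R : ℝ) : EReal) ≤
    Filter.liminf (fun l : ℕ => ((1 / (l : ℝ) * Real.logb 2 (k l) : ℝ) : EReal)) Filter.atTop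

/-- `R` is an achievable entanglement transmission rate with random codes. -/
def EntAchievable (N : S → Channel a b) (R : ℝ≥0) : Prop :=
  ∃ (k : ℕ → ℕ) (C : ∀ l : ℕ, EntCode N l (k l)), RateAtLeast k R ∧
    Filter.Tendsto (fun l => (C l).performance) Filter.atTop (nhds 1)

/-- `R` is a deterministically achievable entanglement transmission rate. -/
def EntDetAchievable (N : S → Channel a b) (R : ℝ≥0) : Prop :=
  ∃ (k : ℕ → ℕ) (C : ∀ l : ℕ, EntCode N l (k l)), (∀ l, (C l).IsDeterministic) ∧
    RateAtLeast k R ∧ Filter.Tendsto (fun l => (C l).performance) Filter.atTop (nhds 1)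

/-- `R` is an achievable strong subspace transmission rate with random codes. -/
def StrongAchievable (N : S → Channel a b) (R : ℝ≥0) : Prop :=
  ∃ (k : ℕ → ℕ) (C : ∀ l : ℕ, StrongCode N l (k l)), RateAtLeast k R ∧
    Filter.Tendsto (fun l => (C l).performance) Filter.atTop (nhds 1)

/-- `R` is a deterministically achievable strong subspace transmission rate. -/
def StrongDetAchievable (N : S → Channel a b) (R : ℝ≥0) : Prop :=
  ∃ (k : ℕ → ℕ) (C : ∀ l : ℕ, StrongCode N l (k l)), (∀ l, (C l).toEntCode.IsDeterministic) ∧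
    RateAtLeast k R ∧ Filter.Tendsto (fun l => (C l).performance) Filter.atTop (nhds 1)

/-- The random entanglement transmission capacity. -/
noncomputable def entCapacity (N : S → Channel a b) : ℝ≥0∞ :=
  ⨆ (R : ℝ≥0) (_ : EntAchievable N R), (R : ℝ≥0∞)

/-- The deterministic entanglement transmission capacity. -/
noncomputable def entDetCapacity (N : S → Channel a b) : ℝ≥0∞ :=
  ⨆ (R : ℝ≥0) (_ : EntDetAchievable N R), (R : ℝ≥0∞)

/-- The random strong subspace transmission capacity. -/
noncomputable def strongCapacity (N : S → Channel a b) : ℝ≥0∞ :=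
  ⨆ (R : ℝ≥0) (_ : StrongAchievable N R), (R : ℝ≥0∞)

/-- The deterministic strong subspace transmission capacity. -/
noncomputable def strongDetCapacity (N : S → Channel a b) : ℝ≥0∞ :=
  ⨆ (R : ℝ≥0) (_ : StrongDetAchievable N R), (R : ℝ≥0∞)

end Codes

end AVQC

/-!
Each of the two notions of transmission is converted into the other one.

*From strong subspace transmission to entanglement transmission.* If `A_r` are Kraus operators of
the total channel `Λ` of a code, followed by the projection to the code space, then the entanglement
fidelity is `k⁻² ∑_r |tr A_r|²`, the average over all pairs `i, j` of basis vectors of the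
coherences `∑_r Re ((A_r)_ii conj (A_r)_jj)`. Each coherence is bounded below by the fidelities of
the four unit vectors `e_i`, `e_j` and `(e_i ± e_j) / √2` (`IsKraus.pairBound_le`). The bound is
linear in `Λ`, so it survives the integral over the random code, and the same codes achieve the same
rates (`StrongCode.le_performance_toEntCode`, `tendsto_performance_toEntCode`).

*From entanglement transmission to strong subspace transmission.* An entanglement fidelity of at
least `1 - ε` bounds the infidelity of every unit vector `ψ` by `2 ⟨ψ, H ψ⟩` with a defect operator
`0 ≤ H ≤ 2` of normalized trace at most `ε` (`HasKraus.exists_defect`). A Gaussian random subspace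
of dimension `D` of the code space of dimension `k` is good for one such `H`, up to probability
`exp (-c k)` for each vector of a net of the unit sphere of `ℂ^D`. Hence one subspace is good
for all members of a finite family of defect operators, as long as their number times the size
of the net is at most exponential in `k` (`exists_isometry_quadForm_le`); the exponential moments
are determinants (`lintegral_exp_neg_quadForm`, `exp_le_det`), and no concentration inequality on
the sphere is needed.

The set of state sequences `s^l` may be infinite, but the matrix elements of the channels lie in a
compact set, so the channels have a finite net (`exists_finset_net_complex`). Its resolution has to
be exponentially small in `l`, because matrix elements on `l` factors are compared
(`overlap_codeMap_sub_le`), so the number of sequences to be considered is `exp (O(l²))`. The net of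
the new code space has size `exp (O(l D))`. If `D = 2^(l R')` with `R'` below the given rate, then
both are negligible against the doubly exponential `exp (c k)` (`eventually_card_nets_le`).

The new code encodes the subspace as part of the old code space. It uses a finitely supported
average of the old encoder-decoder pairs, which exists for finitely many state sequences because an
integral lies in the closed convex hull of the values of the integrand
(`EntCode.exists_finite_average`), so no measurability question arises for the pure state
fidelities. A deterministic code stays deterministic (`EntCode.exists_strongCode`). Every rate
below an achievable entanglement transmission rate is therefore an achievable strong subspace
transmission rate, and the suprema agree.
-/

namespace AVQC

open scoped ENNReal NNReal MeasureTheory Matrix MatrixOrder ComplexOrder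

/-! ### Vectors in coordinates -/

/-- The squared Euclidean norm of a coordinate vector. -/
noncomputable def sqNorm {n : Type*} [Fintype n] (v : n → ℂ) : ℝ := ∑ i, ‖v i‖ ^ 2

section Vectors

variable {m n : Type*} [Fintype m] [Fintype n]

lemma sqNorm_nonneg (v : n → ℂ) : 0 ≤ sqNorm v :=
  Finset.sum_nonneg fun _ _ => by positivity

lemma star_dotProduct_self (v : n → ℂ) : star v ⬝ᵥ v = (sqNorm v : ℂ) := by
  simp [sqNorm, dotProduct, Complex.conj_mul']

lemma sqNorm_eq_norm_toLp (v : n → ℂ) : sqNorm v = ‖WithLp.toLp 2 v‖ ^ 2 := by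
  rw [EuclideanSpace.norm_sq_eq]
  rfl

lemma sqNorm_single [DecidableEq n] (i : n) : sqNorm (Pi.single i 1 : n → ℂ) = 1 := by
  rw [sqNorm, Finset.sum_eq_single i]
  · simp
  · intro j _ hj; simp [Pi.single_eq_of_ne hj]
  · simp

lemma norm_sq_le_sqNorm (v : n → ℂ) (i : n) : ‖v i‖ ^ 2 ≤ sqNorm v :=
  Finset.single_le_sum (f := fun i => ‖v i‖ ^ 2) (fun _ _ => by positivity) (Finset.mem_univ i)

lemma sqrt_sqNorm_sub_le (u v : n → ℂ) :
    √(sqNorm u) ≤ √(sqNorm v) + √(sqNorm (u - v)) := by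
  simp only [sqNorm_eq_norm_toLp, Real.sqrt_sq (norm_nonneg _)]
  have := norm_add_le (WithLp.toLp 2 v) (WithLp.toLp 2 (u - v))
  rwa [← WithLp.toLp_add, add_sub_cancel] at this

lemma sqNorm_sub_comm (u v : n → ℂ) :
    sqNorm (u - v) = sqNorm (v - u) := by
  simp [sqNorm, norm_sub_rev]

lemma sqNorm_smul (c : ℂ) (v : n → ℂ) :
    sqNorm (c • v) = ‖c‖ ^ 2 * sqNorm v := by
  simp [sqNorm, mul_pow, Finset.mul_sum]

lemma sqNorm_eq_zero {v : n → ℂ} : sqNorm v = 0 ↔ v = 0 := by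
  rw [sqNorm_eq_norm_toLp, sq_eq_zero_iff, norm_eq_zero]
  simp

lemma quadForm_smul (H : Matrix n n ℂ) (c : ℂ) (y : n → ℂ) :
    (star (c • y) ⬝ᵥ (H *ᵥ (c • y))).re = ‖c‖ ^ 2 * (star y ⬝ᵥ (H *ᵥ y)).re := by
  rw [Matrix.mulVec_smul, dotProduct_smul, star_smul, smul_dotProduct, smul_eq_mul, smul_eq_mul,
    ← mul_assoc, Complex.star_def, Complex.mul_conj', ← Complex.ofReal_pow, Complex.re_ofReal_mul]

lemma exists_unit_smul {x : n → ℂ} (hx : x ≠ 0) :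
    ∃ (c : ℂ) (u : n → ℂ), c ≠ 0 ∧ sqNorm u = 1 ∧ x = c • u := by
  have h0 : 0 < sqNorm x := lt_of_le_of_ne (sqNorm_nonneg x) fun h => hx (sqNorm_eq_zero.mp h.symm)
  have h1 : ((√(sqNorm x) : ℝ) : ℂ) ≠ 0 := by
    exact_mod_cast (Real.sqrt_pos.mpr h0).ne'
  refine ⟨((√(sqNorm x) : ℝ) : ℂ), ((√(sqNorm x) : ℝ) : ℂ)⁻¹ • x, h1, ?_, ?_⟩
  · rw [sqNorm_smul, norm_inv, inv_pow, Complex.norm_real, Real.norm_eq_abs, sq_abs,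
      Real.sq_sqrt h0.le, inv_mul_cancel₀ h0.ne']
  · rw [smul_smul, mul_inv_cancel₀ h1, one_smul]

lemma norm_star_dotProduct_le (u v : n → ℂ) :
    ‖star u ⬝ᵥ v‖ ≤ √(sqNorm u) * √(sqNorm v) := by
  rw [sqNorm_eq_norm_toLp, sqNorm_eq_norm_toLp, Real.sqrt_sq (norm_nonneg _),
    Real.sqrt_sq (norm_nonneg _)]
  have := norm_inner_le_norm (𝕜 := ℂ) (WithLp.toLp 2 u) (WithLp.toLp 2 v)
  rwa [EuclideanSpace.inner_toLp_toLp, dotProduct_comm] at this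

lemma norm_star_dotProduct_sq_le (u v : n → ℂ) :
    ‖star u ⬝ᵥ v‖ ^ 2 ≤ sqNorm u * sqNorm v := by
  refine (pow_le_pow_left₀ (norm_nonneg _) (norm_star_dotProduct_le u v) 2).trans_eq ?_
  rw [mul_pow, Real.sq_sqrt (sqNorm_nonneg u), Real.sq_sqrt (sqNorm_nonneg v)]

lemma star_mulVec_dotProduct (A : Matrix m n ℂ) (u : n → ℂ) (v : m → ℂ) :
    star (A *ᵥ u) ⬝ᵥ v = star u ⬝ᵥ (Aᴴ *ᵥ v) := by
  rw [Matrix.star_mulVec, Matrix.dotProduct_mulVec]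

lemma sqNorm_mulVec_eq (A : Matrix m n ℂ) (v : n → ℂ) :
    ((sqNorm (A *ᵥ v) : ℝ) : ℂ) = star v ⬝ᵥ ((Aᴴ * A) *ᵥ v) := by
  rw [← star_dotProduct_self, star_mulVec_dotProduct, Matrix.mulVec_mulVec]

lemma sqNorm_mulVec_of_isometry [DecidableEq n] {A : Matrix m n ℂ} (h : Aᴴ * A = 1) (v : n → ℂ) :
    sqNorm (A *ᵥ v) = sqNorm v := by
  have := sqNorm_mulVec_eq A v
  rw [h, Matrix.one_mulVec, star_dotProduct_self] at this
  exact_mod_cast this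

omit [Fintype m] in
lemma proj_mulVec (A : Matrix m n ℂ) (v : n → ℂ) : proj (A *ᵥ v) = A * proj v * Aᴴ := by
  simp [proj, Matrix.mul_vecMulVec, Matrix.vecMulVec_mul, Matrix.star_mulVec]

end Vectors

/-! ### Kraus representations -/

section Kraus

variable {ι a b c : Type*} [Fintype ι] [Fintype a] [DecidableEq a] [Fintype b] [Fintype c]

/-- `A` is a family of Kraus operators of the trace preserving map `Λ`. -/
def IsKraus (Λ : Matrix a a ℂ →ₗ[ℂ] Matrix b b ℂ) (A : ι → Matrix b a ℂ) : Prop :=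
  (∀ X, Λ X = ∑ i, A i * X * (A i)ᴴ) ∧ ∑ i, (A i)ᴴ * A i = 1

/-- `Λ` is completely positive and trace preserving, expressed by the existence of a Kraus
representation. -/
def HasKraus (Λ : Matrix a a ℂ →ₗ[ℂ] Matrix b b ℂ) : Prop :=
  ∃ (n : ℕ) (A : Fin n → Matrix b a ℂ), IsKraus Λ A

lemma IsKraus.hasKraus {Λ : Matrix a a ℂ →ₗ[ℂ] Matrix b b ℂ} {A : ι → Matrix b a ℂ}
    (h : IsKraus Λ A) : HasKraus Λ := by
  refine ⟨Fintype.card ι, A ∘ (Fintype.equivFin ι).symm, fun X => ?_, ?_⟩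
  · rw [h.1]
    exact ((Fintype.equivFin ι).symm.sum_comp fun i => A i * X * (A i)ᴴ).symm
  · rw [← h.2]
    exact (Fintype.equivFin ι).symm.sum_comp fun i => (A i)ᴴ * A i

lemma HasKraus.comp [DecidableEq b] {Λ : Matrix a a ℂ →ₗ[ℂ] Matrix b b ℂ}
    {Γ : Matrix b b ℂ →ₗ[ℂ] Matrix c c ℂ} (hΓ : HasKraus Γ) (hΛ : HasKraus Λ) :
    HasKraus (Γ ∘ₗ Λ) := by
  obtain ⟨m, A, hA, hA'⟩ := hΛ
  obtain ⟨n, B, hB, hB'⟩ := hΓ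
  refine IsKraus.hasKraus (A := fun p : Fin n × Fin m => B p.1 * A p.2) ⟨fun X => ?_, ?_⟩
  · simp only [LinearMap.comp_apply, hA, hB, Fintype.sum_prod_type, Matrix.mul_sum,
      Matrix.sum_mul, Matrix.conjTranspose_mul, Matrix.mul_assoc]
  · have : ∀ p : Fin n × Fin m, (B p.1 * A p.2)ᴴ * (B p.1 * A p.2) =
        (A p.2)ᴴ * ((B p.1)ᴴ * B p.1) * A p.2 := fun p => by
      simp only [Matrix.conjTranspose_mul, Matrix.mul_assoc]
    simp only [this, Fintype.sum_prod_type_right, ← Matrix.mul_sum, ← Matrix.sum_mul, hB',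
      Matrix.mul_one, hA']

/-- The map `X ↦ V X Vᴴ`. -/
def conjMap (V : Matrix b a ℂ) : Matrix a a ℂ →ₗ[ℂ] Matrix b b ℂ where
  toFun X := V * X * Vᴴ
  map_add' X Y := by simp [Matrix.mul_add, Matrix.add_mul]
  map_smul' r X := by simp

lemma hasKraus_conjMap {V : Matrix b a ℂ} (hV : Vᴴ * V = 1) : HasKraus (conjMap V) :=
  ⟨1, fun _ => V, fun X => by simp [conjMap], by simpa using hV⟩

/-- Mixing with probabilities `w i` keeps complete positivity and trace preservation: the Kraus
operators of all maps are collected, those of the `i`-th one with the factor `√(w i)`. -/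
lemma HasKraus.convex_sum {w : ι → ℝ} (hw : ∀ i, 0 ≤ w i) (hw1 : ∑ i, w i = 1)
    {Λ : ι → (Matrix a a ℂ →ₗ[ℂ] Matrix b b ℂ)} (h : ∀ i, HasKraus (Λ i)) :
    HasKraus (∑ i, ((w i : ℝ) : ℂ) • Λ i) := by
  choose n A hA hA' using h
  have hs : ∀ i, ((√(w i) : ℝ) : ℂ) * ((√(w i) : ℝ) : ℂ) = ((w i : ℝ) : ℂ) := fun i => by
    rw [← Complex.ofReal_mul, Real.mul_self_sqrt (hw i)]
  refine IsKraus.hasKraus (A := fun p : Σ i, Fin (n i) => ((√(w p.1) : ℝ) : ℂ) • A p.1 p.2)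
    ⟨fun X => ?_, ?_⟩
  · simp only [LinearMap.sum_apply, LinearMap.smul_apply, hA, Fintype.sum_sigma, Finset.smul_sum,
      Matrix.conjTranspose_smul, Matrix.smul_mul, Matrix.mul_smul, smul_smul, RCLike.star_def,
      Complex.conj_ofReal, hs]
  · simp only [Fintype.sum_sigma, Matrix.conjTranspose_smul, Matrix.smul_mul, Matrix.mul_smul,
      smul_smul, RCLike.star_def, Complex.conj_ofReal, hs, ← Finset.smul_sum, hA']
    rw [← Finset.sum_smul, ← Complex.ofReal_sum, hw1]
    simp

lemma kraus_single_apply {Λ : Matrix a a ℂ →ₗ[ℂ] Matrix b b ℂ} {A : ι → Matrix b a ℂ}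
    (h : IsKraus Λ A) (p q : a) (u v : b) :
    Λ (Matrix.single p q 1) u v = ∑ j, A j u p * star (A j v q) := by
  rw [h.1, Matrix.sum_apply]
  refine Finset.sum_congr rfl fun j _ => ?_
  rw [Matrix.mul_assoc, Matrix.mul_apply, Finset.sum_eq_single p]
  · rw [Matrix.single_mul_apply_same]
    simp
  · intro x _ hx
    rw [Matrix.single_mul_apply_of_ne _ _ _ _ _ hx]
    simp
  · simp

omit [Fintype a] in
lemma prod_one_apply {l : ℕ} (x y : Fin l → a) :
    (∏ i, (1 : Matrix a a ℂ) (x i) (y i)) = (1 : Matrix (Fin l → a) (Fin l → a) ℂ) x y := by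
  by_cases h : x = y
  · subst h; simp
  · obtain ⟨i, hi⟩ := Function.ne_iff.mp h
    rw [Matrix.one_apply_ne h]
    exact Finset.prod_eq_zero (Finset.mem_univ i) (Matrix.one_apply_ne hi)

/-- The products of Kraus operators of the factors are Kraus operators of the tensor product. -/
lemma HasKraus.tensorMap {l : ℕ} {Φ : Fin l → (Matrix a a ℂ →ₗ[ℂ] Matrix b b ℂ)}
    (h : ∀ i, HasKraus (Φ i)) : HasKraus (tensorMap Φ) := by
  choose n A hA using h
  refine IsKraus.hasKraus (A := fun j : ∀ i, Fin (n i) =>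
    Matrix.of fun y x => ∏ i, A i (j i) (y i) (x i)) ⟨fun X => ?_, ?_⟩
  · ext y y'
    simp only [AVQC.tensorMap, LinearMap.coe_mk, AddHom.coe_mk, Matrix.of_apply,
      fun i => kraus_single_apply (hA i), Finset.prod_univ_sum, Fintype.piFinset_univ,
      Matrix.sum_apply, Matrix.mul_apply, Matrix.conjTranspose_apply, Finset.sum_mul,
      Finset.mul_sum, Finset.prod_mul_distrib, star_prod]
    rw [Finset.sum_comm]
    conv_rhs => rw [Finset.sum_comm]
    refine Finset.sum_congr rfl fun x' _ => ?_
    rw [Finset.sum_comm]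
    refine Finset.sum_congr rfl fun x _ => Finset.sum_congr rfl fun j _ => ?_
    ring
  · ext x x'
    rw [← prod_one_apply]
    have : ∀ i, (1 : Matrix a a ℂ) (x i) (x' i) =
        ∑ j, ∑ y, star (A i j y (x i)) * A i j y (x' i) := fun i => by
      rw [← (hA i).2]
      simp [Matrix.sum_apply, Matrix.mul_apply]
    simp only [this, Finset.prod_univ_sum, Fintype.piFinset_univ, Matrix.sum_apply,
      Matrix.mul_apply, Matrix.conjTranspose_apply, Matrix.of_apply, star_prod,
      Finset.prod_mul_distrib]

end Kraus

/-! ### Complete positivity and Kraus representations -/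

section ChoiMatrix

open scoped Matrix.Norms.L2Operator

variable {n a b : Type*} [Fintype n] [DecidableEq n] [Fintype a] [DecidableEq a] [Fintype b]
  [DecidableEq b]

/-- Positivity in the C⋆-algebra of operator-valued matrices is positive semidefiniteness of the
matrix with scalar entries that is obtained by removing the inner brackets. -/
lemma cstarMatrix_nonneg_iff (M : CStarMatrix n n (Matrix a a ℂ)) :
    0 ≤ M ↔ (Matrix.comp n n a a ℂ (CStarMatrix.ofMatrix.symm M)).PosSemidef := by
  have key : ∀ N : CStarMatrix n n (Matrix a a ℂ),
      Matrix.comp n n a a ℂ (CStarMatrix.ofMatrix.symm (star N * N)) =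
      (Matrix.comp n n a a ℂ (CStarMatrix.ofMatrix.symm N))ᴴ *
        Matrix.comp n n a a ℂ (CStarMatrix.ofMatrix.symm N) := by
    intro N
    ext ⟨i, u⟩ ⟨j, v⟩
    simp only [Matrix.comp_apply, Matrix.mul_apply, Matrix.conjTranspose_apply,
      Fintype.sum_prod_type]
    change ((star N * N) i j) u v = _
    rw [CStarMatrix.mul_apply, Matrix.sum_apply]
    rfl
  constructor
  · intro h
    rw [StarOrderedRing.nonneg_iff] at h
    induction h using AddSubmonoid.closure_induction with
    | mem x hx =>
      obtain ⟨N, rfl⟩ := hx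
      rw [key]
      exact Matrix.posSemidef_conjTranspose_mul_self _
    | zero => exact Matrix.PosSemidef.zero
    | add x y _ _ hx hy => exact hx.add hy
  · intro h
    obtain ⟨B, hB⟩ := CStarAlgebra.nonneg_iff_eq_star_mul_self.mp h.nonneg
    have : M = star (CStarMatrix.ofMatrix ((Matrix.comp n n a a ℂ).symm B)) *
        CStarMatrix.ofMatrix ((Matrix.comp n n a a ℂ).symm B) := by
      apply CStarMatrix.ofMatrix.symm.injective
      apply (Matrix.comp n n a a ℂ).injective
      rw [key, hB, Matrix.star_eq_conjTranspose]
      simp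
    rw [this]
    exact star_mul_self_nonneg _

/-- The Choi matrix of a channel is positive semidefinite, and the rows of a factor `B` with
`Bᴴ B` equal to the Choi matrix are conjugate to the entries of Kraus operators. -/
lemma Channel.hasKraus (Φ : Channel a b) : HasKraus Φ.lin := by
  let M : CStarMatrix a a (Matrix a a ℂ) := CStarMatrix.ofMatrix fun i j => Matrix.single i j 1
  have hM : 0 ≤ M := by
    rw [cstarMatrix_nonneg_iff]
    convert Matrix.posSemidef_vecMulVec_self_star
      (fun p : a × a => if p.1 = p.2 then (1 : ℂ) else 0)
    ext ⟨i, u⟩ ⟨j, v⟩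
    change Matrix.single i j (1 : ℂ) u v = _
    simp only [Matrix.single_apply, Matrix.vecMulVec_apply, Pi.star_apply]
    by_cases h1 : i = u <;> by_cases h2 : j = v <;> simp [h1, h2]
  have h := (cstarMatrix_nonneg_iff _).mp (Φ.toCompletelyPositiveMap.map_cstarMatrix_nonneg M hM)
  obtain ⟨B, hB⟩ := CStarAlgebra.nonneg_iff_eq_star_mul_self.mp h.nonneg
  have hC : ∀ i j u v, Φ.lin (Matrix.single i j 1) u v = ∑ r, star (B r (i, u)) * B r (j, v) := by
    intro i j u v
    have := congrFun (congrFun hB (i, u)) (j, v)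
    rw [Matrix.mul_apply] at this
    exact this
  obtain ⟨K, hKB⟩ : ∃ K : a × b → Matrix b a ℂ, ∀ r u i, K r u i = star (B r (i, u)) :=
    ⟨fun r => Matrix.of fun u i => star (B r (i, u)), fun _ _ _ => rfl⟩
  have hK : ∀ X, Φ.lin X = ∑ r, K r * X * (K r)ᴴ := by
    intro X
    ext u v
    conv_lhs => rw [Matrix.matrix_eq_sum_single X]
    have hs : ∀ p q, Matrix.single p q (X p q) = X p q • Matrix.single p q (1 : ℂ) := fun p q => by
      simp [Matrix.smul_single]
    simp only [map_sum, Matrix.sum_apply, hs, map_smul, Matrix.smul_apply, hC, Matrix.mul_apply,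
      hKB, Matrix.conjTranspose_apply, star_star, smul_eq_mul, Finset.mul_sum,
      Finset.sum_mul]
    rw [Finset.sum_comm]
    conv_rhs => rw [Finset.sum_comm]
    refine Finset.sum_congr rfl fun j _ => ?_
    rw [Finset.sum_comm]
    exact Finset.sum_congr rfl fun r _ => Finset.sum_congr rfl fun i _ => by ring
  refine IsKraus.hasKraus ⟨hK, ?_⟩
  rw [Matrix.ext_iff_trace_mul_right]
  intro X
  rw [Matrix.one_mul, ← show (Φ.lin X).trace = X.trace from Φ.trace_preserving X, hK,
    Matrix.sum_mul, Matrix.trace_sum, Matrix.trace_sum]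
  refine Finset.sum_congr rfl fun r _ => ?_
  rw [Matrix.mul_assoc, Matrix.trace_mul_comm]

lemma HasKraus.exists_channel {Λ : Matrix a a ℂ →ₗ[ℂ] Matrix b b ℂ} (h : HasKraus Λ) :
    ∃ Φ : Channel a b, Φ.lin = Λ := by
  obtain ⟨n, A, hA, hA1⟩ := h
  refine ⟨⟨⟨Λ, fun k M hM => ?_⟩, fun X => ?_⟩, rfl⟩
  · rw [cstarMatrix_nonneg_iff] at hM ⊢
    have hsum := Matrix.posSemidef_sum Finset.univ fun (r : Fin n) _ =>
      hM.mul_mul_conjTranspose_same (Matrix.of fun (p : Fin k × b) (q : Fin k × a) =>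
        if p.1 = q.1 then A r p.2 q.2 else 0)
    convert hsum
    ext ⟨i, u⟩ ⟨j, v⟩
    change Λ (M i j) u v = _
    rw [hA, Matrix.sum_apply, Matrix.sum_apply]
    refine Finset.sum_congr rfl fun r _ => ?_
    simp only [Matrix.mul_apply, Fintype.sum_prod_type, Matrix.of_apply,
      Matrix.conjTranspose_apply, ite_mul, zero_mul, apply_ite star, star_zero, mul_ite, mul_zero]
    simp only [Finset.sum_ite_irrel, Finset.sum_const_zero, Finset.sum_ite_eq, Finset.mem_univ,
      if_true]
    rfl
  · change (Λ X).trace = X.trace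
    rw [hA, Matrix.trace_sum]
    simp only [Matrix.trace_mul_cycle _ X]
    rw [← Matrix.trace_sum, ← Matrix.sum_mul, hA1, Matrix.one_mul]

end ChoiMatrix

/-! ### Fidelities in terms of Kraus operators -/

section Fidelity

variable {n : Type*} [Fintype n]

lemma proj_posSemidef (v : n → ℂ) : (proj v).PosSemidef :=
  Matrix.posSemidef_vecMulVec_self_star v

lemma proj_mul_proj (v : n → ℂ) : proj v * proj v = (sqNorm v : ℂ) • proj v := by
  rw [proj, Matrix.vecMulVec_mul_vecMulVec, star_dotProduct_self]
  ext i j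
  simp [Matrix.vecMulVec_apply, mul_left_comm]

lemma trace_proj (v : n → ℂ) : (proj v).trace = (sqNorm v : ℂ) := by
  rw [proj, Matrix.trace_vecMulVec, dotProduct_comm, star_dotProduct_self]

lemma star_dotProduct_proj_mulVec (u w : n → ℂ) :
    star u ⬝ᵥ (proj w *ᵥ u) = ((‖star u ⬝ᵥ w‖ ^ 2 : ℝ) : ℂ) := by
  rw [proj, Matrix.vecMulVec_mulVec, dotProduct_smul]
  have : star w ⬝ᵥ u = star (star u ⬝ᵥ w) := by
    rw [Matrix.star_dotProduct]
  rw [this]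
  simp [Complex.mul_conj']

/-- The absolute value of `|u⟩⟨u| S` is the rank one operator with range spanned by `S u` and trace
`‖S u‖`. -/
lemma traceNorm_proj_mul [DecidableEq n] {u : n → ℂ} {S : Matrix n n ℂ}
    (hu : sqNorm u = 1) (hS : Sᴴ = S) :
    traceNorm (proj u * S) ^ 2 = sqNorm (S *ᵥ u) := by
  have hpu : (proj u)ᴴ = proj u := (proj_posSemidef u).isHermitian
  have h1 : star (proj u * S) * (proj u * S) = proj (S *ᵥ u) := by
    rw [Matrix.star_eq_conjTranspose, Matrix.conjTranspose_mul, hpu, hS, Matrix.mul_assoc,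
      ← Matrix.mul_assoc (proj u), proj_mul_proj, hu, proj_mulVec, hS]
    simp [Matrix.mul_assoc]
  set w := S *ᵥ u
  have h0 := sqNorm_nonneg w
  have h2 : CFC.sqrt (proj w) = (((√(sqNorm w))⁻¹ : ℝ) : ℂ) • proj w := by
    apply CFC.sqrt_unique
    · rw [Matrix.smul_mul, Matrix.mul_smul, proj_mul_proj, smul_smul, smul_smul]
      -- if `w = 0`, the root is zero, and so is `0⁻¹` times the projection
      rcases h0.eq_or_lt with h | h
      · have : proj w = 0 := by
          have hw : w = 0 := by
            rw [sqNorm_eq_norm_toLp, eq_comm, sq_eq_zero_iff, norm_eq_zero] at h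
            simpa using h
          ext i j
          simp [proj, hw]
        simp [this]
      · rw [← Complex.ofReal_mul, ← Complex.ofReal_mul, ← mul_inv, Real.mul_self_sqrt h0,
          inv_mul_cancel₀ h.ne']
        simp
    · rw [Matrix.nonneg_iff_posSemidef]
      exact (proj_posSemidef w).smul (by
        rw [Complex.zero_le_real]
        positivity)
  rw [traceNorm, CFC.abs, h1, h2, Matrix.trace_smul, trace_proj, smul_eq_mul, ← Complex.ofReal_mul,
    Complex.ofReal_re, mul_pow, inv_pow, Real.sq_sqrt h0]
  rcases h0.eq_or_lt with h | h
  · simp [← h]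
  · field_simp

lemma fidelity_proj [DecidableEq n] {u : n → ℂ} {σ : Matrix n n ℂ} (hu : sqNorm u = 1)
    (hσ : σ.PosSemidef) : fidelity (proj u) σ = (star u ⬝ᵥ (σ *ᵥ u)).re := by
  have hs : CFC.sqrt (proj u) = proj u :=
    CFC.sqrt_unique (by rw [proj_mul_proj, hu]; simp)
      (Matrix.nonneg_iff_posSemidef.mpr (proj_posSemidef u))
  have hS : (CFC.sqrt σ)ᴴ = CFC.sqrt σ :=
    (Matrix.nonneg_iff_posSemidef.mp (CFC.sqrt_nonneg σ)).isHermitian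
  rw [fidelity, hs, traceNorm_proj_mul hu hS]
  have := sqNorm_mulVec_eq (CFC.sqrt σ) u
  rw [hS, CFC.sqrt_mul_sqrt_self σ (Matrix.nonneg_iff_posSemidef.mpr hσ)] at this
  rw [← this, Complex.ofReal_re]

end Fidelity

section Overlap

variable {k d : ℕ} {ι : Type*} [Fintype ι]

/-- The number `⟨Jψ, Λ(|ψ⟩⟨ψ|) Jψ⟩`. In contrast to the fidelity, it is linear in `Λ`. -/
noncomputable def overlap (J : Matrix (Fin d) (Fin k) ℂ)
    (Λ : Matrix (Fin k) (Fin k) ℂ →ₗ[ℂ] Matrix (Fin d) (Fin d) ℂ) (ψ : Fin k → ℂ) : ℝ :=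
  (star (J *ᵥ ψ) ⬝ᵥ (Λ (proj ψ) *ᵥ (J *ᵥ ψ))).re

variable {J : Matrix (Fin d) (Fin k) ℂ}
  {Λ : Matrix (Fin k) (Fin k) ℂ →ₗ[ℂ] Matrix (Fin d) (Fin d) ℂ}
  {A : ι → Matrix (Fin d) (Fin k) ℂ}

lemma IsKraus.map_proj (h : IsKraus Λ A) (ψ : Fin k → ℂ) :
    Λ (proj ψ) = ∑ j, proj (A j *ᵥ ψ) := by
  rw [h.1]
  simp only [proj_mulVec]

lemma HasKraus.posSemidef_map_proj (h : HasKraus Λ) (ψ : Fin k → ℂ) :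
    (Λ (proj ψ)).PosSemidef := by
  obtain ⟨n, A, hA⟩ := h
  rw [hA.map_proj]
  exact Matrix.posSemidef_sum _ fun _ _ => proj_posSemidef _

lemma vectorFidelity_eq_overlap (hJ : Jᴴ * J = 1) (hΛ : HasKraus Λ) {ψ : Fin k → ℂ}
    (hψ : sqNorm ψ = 1) : vectorFidelity J Λ ψ = overlap J Λ ψ :=
  fidelity_proj (by rw [sqNorm_mulVec_of_isometry hJ, hψ]) (hΛ.posSemidef_map_proj ψ)

lemma IsKraus.overlap_eq (h : IsKraus Λ A) (J : Matrix (Fin d) (Fin k) ℂ) (ψ : Fin k → ℂ) :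
    overlap J Λ ψ = ∑ j, ‖star ψ ⬝ᵥ ((Jᴴ * A j) *ᵥ ψ)‖ ^ 2 := by
  rw [overlap, h.map_proj, Matrix.sum_mulVec, dotProduct_sum, Complex.re_sum]
  refine Finset.sum_congr rfl fun j _ => ?_
  rw [star_dotProduct_proj_mulVec, Complex.ofReal_re, star_mulVec_dotProduct, Matrix.mulVec_mulVec]

lemma IsKraus.sum_sqNorm_mulVec {a b : Type*} [Fintype a] [DecidableEq a] [Fintype b]
    {Λ : Matrix a a ℂ →ₗ[ℂ] Matrix b b ℂ} {A : ι → Matrix b a ℂ} (h : IsKraus Λ A) (ψ : a → ℂ) :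
    ∑ j, sqNorm (A j *ᵥ ψ) = sqNorm ψ := by
  have : ((∑ j, sqNorm (A j *ᵥ ψ) : ℝ) : ℂ) = sqNorm ψ := by
    rw [Complex.ofReal_sum]
    simp only [sqNorm_mulVec_eq]
    rw [← dotProduct_sum, ← Matrix.sum_mulVec, h.2, Matrix.one_mulVec, star_dotProduct_self]
  exact_mod_cast this

lemma sqNorm_conjTranspose_mulVec_le (hJ : Jᴴ * J = 1) (v : Fin d → ℂ) :
    sqNorm (Jᴴ *ᵥ v) ≤ sqNorm v := by
  have h1 : ((sqNorm (Jᴴ *ᵥ v) : ℝ) : ℂ) = star (J *ᵥ (Jᴴ *ᵥ v)) ⬝ᵥ v := by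
    rw [star_mulVec_dotProduct, star_dotProduct_self]
  have h2 := norm_star_dotProduct_sq_le (J *ᵥ (Jᴴ *ᵥ v)) v
  rw [← h1, sqNorm_mulVec_of_isometry hJ, Complex.norm_real, Real.norm_eq_abs, sq_abs, sq] at h2
  rcases (sqNorm_nonneg (Jᴴ *ᵥ v)).eq_or_lt with h | h
  · rw [← h]; exact sqNorm_nonneg v
  · exact le_of_mul_le_mul_left h2 h

lemma HasKraus.overlap_nonneg (h : HasKraus Λ) (J : Matrix (Fin d) (Fin k) ℂ) (ψ : Fin k → ℂ) :
    0 ≤ overlap J Λ ψ := by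
  obtain ⟨n, A, hA⟩ := h
  rw [hA.overlap_eq]
  positivity

lemma HasKraus.overlap_le_one (h : HasKraus Λ) (hJ : Jᴴ * J = 1) {ψ : Fin k → ℂ}
    (hψ : sqNorm ψ = 1) : overlap J Λ ψ ≤ 1 := by
  obtain ⟨n, A, hA⟩ := h
  rw [hA.overlap_eq, ← hψ, ← hA.sum_sqNorm_mulVec ψ]
  refine Finset.sum_le_sum fun j _ => (norm_star_dotProduct_sq_le _ _).trans ?_
  rw [hψ, one_mul, ← Matrix.mulVec_mulVec]
  exact sqNorm_conjTranspose_mulVec_le hJ _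

lemma IsKraus.entanglementFidelity_eq (h : IsKraus Λ A) (J : Matrix (Fin d) (Fin k) ℂ) :
    entanglementFidelity J Λ = ((k : ℝ) ^ 2)⁻¹ * ∑ j, ‖(Jᴴ * A j).trace‖ ^ 2 := by
  have hs : (((√(k : ℝ))⁻¹ : ℝ) : ℂ) * (((√(k : ℝ))⁻¹ : ℝ) : ℂ) = (k : ℂ)⁻¹ := by
    rw [← Complex.ofReal_mul, ← mul_inv, Real.mul_self_sqrt (Nat.cast_nonneg k)]
    simp
  set r : ℂ := (((√(k : ℝ))⁻¹ : ℝ) : ℂ) with hr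
  have hφ : ∀ p : Fin k × Fin d,
      (J *ᵥ fun j => maxEntangled k (p.1, j)) p.2 = r * J p.2 p.1 := by
    intro p
    simp [Matrix.mulVec, dotProduct, maxEntangled, hr, mul_comm]
  have hT : ∀ p q : Fin k × Fin d, idTensor (Fin k) Λ (proj (maxEntangled k)) p q =
      (k : ℂ)⁻¹ * ∑ j, A j p.2 p.1 * star (A j q.2 q.1) := by
    intro p q
    rw [idTensor, Matrix.of_apply, ← kraus_single_apply h]
    have : (Matrix.of fun i j => proj (maxEntangled k) (p.1, i) (q.1, j)) =
        (k : ℂ)⁻¹ • Matrix.single p.1 q.1 (1 : ℂ) := by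
      ext i j
      simp only [Matrix.of_apply, proj, Matrix.vecMulVec_apply, maxEntangled, Pi.star_apply,
        Matrix.smul_apply, Matrix.single_apply, ← hs, hr]
      by_cases h1 : p.1 = i <;> by_cases h2 : q.1 = j <;> simp [h1, h2]
    rw [this, map_smul, Matrix.smul_apply, smul_eq_mul]
  have hsum : star (fun p : Fin k × Fin d => r * J p.2 p.1) ⬝ᵥ
      (idTensor (Fin k) Λ (proj (maxEntangled k)) *ᵥ fun p => r * J p.2 p.1) =
      (((k : ℝ) ^ 2)⁻¹ * ∑ j, ‖(Jᴴ * A j).trace‖ ^ 2 : ℝ) := by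
    have htr : ∀ j, (Jᴴ * A j).trace = ∑ p : Fin k × Fin d, star (J p.2 p.1) * A j p.2 p.1 := by
      intro j
      simp [Matrix.trace, Matrix.mul_apply, Fintype.sum_prod_type]
    have hrr : star r = r := by simp [hr]
    have hk2 : ((k : ℂ) ^ 2)⁻¹ = r * r * (k : ℂ)⁻¹ := by rw [hs, sq, mul_inv]
    push_cast
    simp only [← Complex.mul_conj', htr, hk2]
    simp only [dotProduct, Matrix.mulVec, hT, Pi.star_apply, star_mul', hrr, map_sum, map_mul,
      Finset.mul_sum, Finset.sum_mul]
    rw [Finset.sum_comm]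
    conv_lhs => enter [2, q]; rw [Finset.sum_comm]
    rw [Finset.sum_comm]
    refine Finset.sum_congr rfl fun j _ => Finset.sum_congr rfl fun q _ =>
      Finset.sum_congr rfl fun p _ => ?_
    simp only [starRingEnd_apply, star_star]
    ring
  unfold entanglementFidelity
  simp only [hφ]
  rw [hsum, Complex.ofReal_re]

lemma IsKraus.overlap_single (h : IsKraus Λ A) (J : Matrix (Fin d) (Fin k) ℂ) (i : Fin k) :
    overlap J Λ (Pi.single i 1) = ∑ j, ‖(Jᴴ * A j) i i‖ ^ 2 := by
  rw [h.overlap_eq]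
  simp

lemma HasKraus.entanglementFidelity_nonneg (h : HasKraus Λ) (J : Matrix (Fin d) (Fin k) ℂ) :
    0 ≤ entanglementFidelity J Λ := by
  obtain ⟨n, A, hA⟩ := h
  rw [hA.entanglementFidelity_eq]
  positivity

lemma HasKraus.entanglementFidelity_le_one (h : HasKraus Λ) (hJ : Jᴴ * J = 1) :
    entanglementFidelity J Λ ≤ 1 := by
  obtain ⟨n, A, hA⟩ := id h
  rw [hA.entanglementFidelity_eq]
  have h1 : ∀ j, ‖(Jᴴ * A j).trace‖ ^ 2 ≤ k * ∑ i, ‖(Jᴴ * A j) i i‖ ^ 2 := by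
    intro j
    refine (pow_le_pow_left₀ (norm_nonneg _) (norm_sum_le _ _) 2).trans ?_
    refine sq_sum_le_card_mul_sum_sq.trans_eq ?_
    simp
  have h2 : ∑ j, ‖(Jᴴ * A j).trace‖ ^ 2 ≤ (k : ℝ) ^ 2 := by
    refine (Finset.sum_le_sum fun j _ => h1 j).trans ?_
    rw [← Finset.mul_sum, Finset.sum_comm, sq]
    refine mul_le_mul_of_nonneg_left ?_ (Nat.cast_nonneg k)
    refine (Finset.sum_le_sum (g := fun _ => (1 : ℝ)) fun i _ => ?_).trans_eq (by simp)
    rw [← hA.overlap_single]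
    exact h.overlap_le_one hJ (sqNorm_single i)
  exact inv_mul_le_one_of_le₀ h2 (by positivity)

end Overlap

/-! ### Entanglement fidelity against fidelities of pure states -/

section PairBound

variable {k d : ℕ} {ι : Type*} [Fintype ι] {J : Matrix (Fin d) (Fin k) ℂ}
  {Λ : Matrix (Fin k) (Fin k) ℂ →ₗ[ℂ] Matrix (Fin d) (Fin d) ℂ}
  {A : ι → Matrix (Fin d) (Fin k) ℂ}

/-- The vector `(e_i + s e_j) / √2`. -/
noncomputable def pairVec (i j : Fin k) (s : ℂ) : Fin k → ℂ :=
  ((√2 : ℝ) : ℂ)⁻¹ • (Pi.single i 1 + s • Pi.single j 1)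

lemma inv_sqrt_two_mul_self : (((√2 : ℝ) : ℂ)⁻¹) * ((√2 : ℝ) : ℂ)⁻¹ = 2⁻¹ := by
  rw [← mul_inv, ← Complex.ofReal_mul, Real.mul_self_sqrt zero_le_two]
  simp

lemma star_pairVec_dotProduct (B : Matrix (Fin k) (Fin k) ℂ) (i j : Fin k) {s : ℂ}
    (hs : star s = s) (hss : s * s = 1) :
    star (pairVec i j s) ⬝ᵥ (B *ᵥ pairVec i j s) =
      2⁻¹ * ((B i i + B j j) + s * (B i j + B j i)) := by
  have h : star (((√2 : ℝ) : ℂ)⁻¹) = ((√2 : ℝ) : ℂ)⁻¹ := by simp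
  have h1 : star (pairVec i j s) = pairVec i j s := by
    ext l
    simp only [pairVec, Pi.star_apply, Pi.smul_apply, Pi.add_apply, smul_eq_mul, star_mul', h,
      star_add, hs, Pi.single_apply, apply_ite star, star_one, star_zero]
  rw [h1, pairVec]
  simp only [Matrix.mulVec_smul, Matrix.mulVec_add, Matrix.mulVec_single_one, dotProduct_smul,
    smul_dotProduct, dotProduct_add, add_dotProduct, single_dotProduct, Matrix.col_apply,
    smul_eq_mul, one_mul]
  rw [← inv_sqrt_two_mul_self]
  linear_combination (((√2 : ℝ) : ℂ)⁻¹) * ((√2 : ℝ) : ℂ)⁻¹ * B j j * hss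

lemma sqNorm_pairVec {i j : Fin k} (hij : i ≠ j) {s : ℂ} (hs : star s = s) (hss : s * s = 1) :
    sqNorm (pairVec i j s) = 1 := by
  have h := star_pairVec_dotProduct (1 : Matrix (Fin k) (Fin k) ℂ) i j hs hss
  rw [Matrix.one_mulVec, star_dotProduct_self, Matrix.one_apply_ne hij,
    Matrix.one_apply_ne hij.symm] at h
  simp only [Matrix.one_apply_eq] at h
  norm_num at h
  exact_mod_cast h

/-- The column `j` of the Kraus operators carries total weight at most one, so that its entry `i`
is small when the fidelity of `e_j` is large. -/
lemma IsKraus.sum_norm_sq_column_le (h : IsKraus Λ A) (hJ : Jᴴ * J = 1) {i j : Fin k}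
    (hij : i ≠ j) :
    ∑ r, (‖(Jᴴ * A r) i j‖ ^ 2 + ‖(Jᴴ * A r) j j‖ ^ 2) ≤ 1 := by
  rw [← sqNorm_single j, ← h.sum_sqNorm_mulVec]
  refine Finset.sum_le_sum fun r _ => ?_
  refine le_trans ?_ (sqNorm_conjTranspose_mulVec_le hJ _)
  rw [Matrix.mulVec_mulVec, Matrix.mulVec_single_one, sqNorm,
    ← Finset.sum_pair (f := fun x => ‖(Jᴴ * A r) x j‖ ^ 2) hij]
  exact Finset.sum_le_sum_of_subset_of_nonneg (Finset.subset_univ _) fun _ _ _ => by positivity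

/-- A lower bound for the matrix element of the entanglement fidelity that belongs to `i` and `j`,
in terms of the fidelities of `e_i`, `e_j` and `(e_i ± e_j) / √2`. -/
noncomputable def pairBound (f : (Fin k → ℂ) → ℝ) (i j : Fin k) : ℝ :=
  if i = j then f (Pi.single i 1) else
    f (pairVec i j 1) + f (pairVec i j (-1)) - 2 + (f (Pi.single i 1) + f (Pi.single j 1)) / 2

/-- With `p, q` the diagonal and `u, v` the off-diagonal entries of a two by two matrix: the
fidelities of `(e_i ± e_j) / √2` exceed the coherence `Re (p q̄)` at most by terms that the
fidelities of `e_i` and `e_j` control. -/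
lemma parallelogram_bound (p q u v : ℂ) :
    ‖2⁻¹ * ((p + q) + 1 * (u + v))‖ ^ 2 + ‖2⁻¹ * ((p + q) + -1 * (u + v))‖ ^ 2 ≤
      (‖p‖ ^ 2 + ‖q‖ ^ 2) / 2 + (p * star q).re + (‖u‖ ^ 2 + ‖v‖ ^ 2) := by
  simp only [← Complex.normSq_eq_norm_sq, Complex.normSq_apply]
  simp
  nlinarith [sq_nonneg (u.re - v.re), sq_nonneg (u.im - v.im)]

lemma IsKraus.pairBound_le (h : IsKraus Λ A) (hJ : Jᴴ * J = 1) (i j : Fin k) :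
    pairBound (overlap J Λ) i j ≤ ∑ r, ((Jᴴ * A r) i i * star ((Jᴴ * A r) j j)).re := by
  unfold pairBound
  split_ifs with hij
  · subst hij
    rw [h.overlap_single]
    refine (Finset.sum_congr rfl fun r _ => ?_).le
    rw [Complex.star_def, Complex.mul_conj']
    norm_cast
  · have h1 := h.sum_norm_sq_column_le hJ hij
    have h2 := h.sum_norm_sq_column_le hJ (Ne.symm hij)
    simp only [h.overlap_single, h.overlap_eq,
      star_pairVec_dotProduct _ i j (star_one ℂ) (one_mul 1),
      star_pairVec_dotProduct _ i j (s := -1) (by simp) (by simp)]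
    have h3 := Finset.sum_le_sum fun r (_ : r ∈ Finset.univ) =>
      parallelogram_bound ((Jᴴ * A r) i i) ((Jᴴ * A r) j j) ((Jᴴ * A r) i j) ((Jᴴ * A r) j i)
    simp only [Finset.sum_add_distrib, ← Finset.sum_div] at h1 h2 h3
    linarith

/-- The entanglement fidelity is the average over all `i` and `j` of the coherences between `e_i`
and `e_j`, and is therefore at least the average of the lower bounds `pairBound`. -/
lemma HasKraus.sum_pairBound_le (h : HasKraus Λ) (hJ : Jᴴ * J = 1) :
    ((k : ℝ) ^ 2)⁻¹ * ∑ i, ∑ j, pairBound (overlap J Λ) i j ≤ entanglementFidelity J Λ := by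
  obtain ⟨n, A, hA⟩ := h
  rw [hA.entanglementFidelity_eq]
  refine mul_le_mul_of_nonneg_left ?_ (by positivity)
  refine (Finset.sum_le_sum fun i _ => Finset.sum_le_sum fun j _ =>
    hA.pairBound_le hJ i j).trans_eq ?_
  have : ∀ r, ‖(Jᴴ * A r).trace‖ ^ 2 =
      ∑ i, ∑ j, ((Jᴴ * A r) i i * star ((Jᴴ * A r) j j)).re := by
    intro r
    have h2 : ((‖(Jᴴ * A r).trace‖ ^ 2 : ℝ) : ℂ) =
        (Jᴴ * A r).trace * star (Jᴴ * A r).trace := by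
      rw [Complex.star_def, Complex.mul_conj']
      push_cast
      rfl
    rw [← Complex.ofReal_re (‖(Jᴴ * A r).trace‖ ^ 2), h2]
    simp only [Matrix.trace, Matrix.diag_apply, star_sum, Finset.sum_mul_sum, Complex.re_sum]
  simp only [this]
  rw [Finset.sum_comm]
  conv_lhs => rw [Finset.sum_comm]
  conv_rhs => rw [Finset.sum_comm]
  refine Finset.sum_congr rfl fun i _ => ?_
  rw [Finset.sum_comm]

end PairBound

/-! ### The defect operator of a channel with large entanglement fidelity -/

section Defect

variable {k d : ℕ} {J : Matrix (Fin d) (Fin k) ℂ}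
  {Λ : Matrix (Fin k) (Fin k) ℂ →ₗ[ℂ] Matrix (Fin d) (Fin d) ℂ}

/-- If the entanglement fidelity is at least `1 - ε`, then the infidelity of every pure state `ψ`
is controlled by a quadratic form `⟨ψ, H ψ⟩` with `0 ≤ H ≤ 2` and normalized trace at most `ε`.
The operator is `H = 1 - Re C` for the combination `C` of the Kraus operators that has the largest
trace. -/
lemma HasKraus.exists_defect (h : HasKraus Λ) (hJ : Jᴴ * J = 1) {ε : ℝ}
    (hF : 1 - ε ≤ entanglementFidelity J Λ) :
    ∃ H : Matrix (Fin k) (Fin k) ℂ, H.PosSemidef ∧ ((2 : ℂ) • 1 - H).PosSemidef ∧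
      H.trace.re ≤ k * ε ∧
      ∀ ψ, sqNorm ψ = 1 → 1 - 2 * (star ψ ⬝ᵥ (H *ᵥ ψ)).re ≤ overlap J Λ ψ := by
  obtain ⟨n, A, hA⟩ := id h
  have hF1 := h.entanglementFidelity_le_one hJ
  have hF0 := h.entanglementFidelity_nonneg J
  have hFe := hA.entanglementFidelity_eq J
  set S : ℝ := ∑ j, ‖(Jᴴ * A j).trace‖ ^ 2 with hS
  have hS0 : 0 ≤ S := by positivity
  let c : Fin n → ℂ := fun j => (((√S)⁻¹ : ℝ) : ℂ) * star (Jᴴ * A j).trace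
  let C : Matrix (Fin k) (Fin k) ℂ := ∑ j, c j • (Jᴴ * A j)
  -- if `S = 0`, then all `c j` vanish by the convention `0⁻¹ = 0`, and `C = 0` will do
  have hc : ∑ j, ‖c j‖ ^ 2 ≤ 1 := by
    have : ∀ j, ‖c j‖ ^ 2 = S⁻¹ * ‖(Jᴴ * A j).trace‖ ^ 2 := fun j => by
      simp only [c, norm_mul, norm_star, Complex.norm_real, Real.norm_eq_abs, mul_pow, sq_abs,
        inv_pow, Real.sq_sqrt hS0]
    simp only [this, ← Finset.mul_sum]
    exact inv_mul_le_one_of_le₀ le_rfl hS0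
  have htr : C.trace = ((√S : ℝ) : ℂ) := by
    have h1 : C.trace = (((√S)⁻¹ * S : ℝ) : ℂ) := by
      simp only [C, c, Matrix.trace_sum, Matrix.trace_smul, smul_eq_mul, mul_assoc,
        ← Finset.mul_sum]
      rw [Complex.ofReal_mul, hS, Complex.ofReal_sum]
      congr 1
      refine Finset.sum_congr rfl fun j _ => ?_
      rw [Complex.star_def, Complex.conj_mul']
      norm_cast
    rw [h1, inv_mul_eq_div, Real.div_sqrt]
  have hquad : ∀ x, star x ⬝ᵥ (C *ᵥ x) = ∑ j, c j * (star x ⬝ᵥ ((Jᴴ * A j) *ᵥ x)) := fun x => by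
    simp only [C, Matrix.sum_mulVec, dotProduct_sum, Matrix.smul_mulVec, dotProduct_smul,
      smul_eq_mul]
  have hC1 : ∀ x, ‖star x ⬝ᵥ (C *ᵥ x)‖ ^ 2 ≤ overlap J Λ x := by
    intro x
    rw [hquad, hA.overlap_eq]
    refine (pow_le_pow_left₀ (norm_nonneg _) (norm_sum_le _ _) 2).trans ?_
    simp only [norm_mul]
    refine (Finset.sum_mul_sq_le_sq_mul_sq _ _ _).trans ?_
    exact mul_le_of_le_one_left (by positivity) hc
  have hC2 : ∀ x, |(star x ⬝ᵥ (C *ᵥ x)).re| ≤ sqNorm x := by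
    intro x
    refine (Complex.abs_re_le_norm _).trans (abs_le_of_sq_le_sq' ?_ (sqNorm_nonneg x)).2
    refine (hC1 x).trans ?_
    rw [hA.overlap_eq, sq]
    conv_rhs => enter [2]; rw [← hA.sum_sqNorm_mulVec x]
    rw [Finset.mul_sum]
    refine Finset.sum_le_sum fun j _ => (norm_star_dotProduct_sq_le _ _).trans ?_
    refine mul_le_mul_of_nonneg_left ?_ (sqNorm_nonneg x)
    rw [← Matrix.mulVec_mulVec]
    exact sqNorm_conjTranspose_mulVec_le hJ _
  have hCstar : ∀ x, star x ⬝ᵥ (Cᴴ *ᵥ x) = star (star x ⬝ᵥ (C *ᵥ x)) := fun x => by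
    rw [← star_mulVec_dotProduct, Matrix.star_dotProduct]
  have hR : ∀ x, star x ⬝ᵥ (((2⁻¹ : ℂ) • (C + Cᴴ)) *ᵥ x) = ((star x ⬝ᵥ (C *ᵥ x)).re : ℂ) := by
    intro x
    rw [Matrix.smul_mulVec, Matrix.add_mulVec, dotProduct_smul, dotProduct_add, hCstar,
      smul_eq_mul, Complex.star_def, Complex.add_conj]
    simp
  have hherm : ((2⁻¹ : ℂ) • (C + Cᴴ)).IsHermitian := by
    rw [Matrix.IsHermitian, Matrix.conjTranspose_smul, Matrix.conjTranspose_add,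
      Matrix.conjTranspose_conjTranspose, add_comm]
    simp
  refine ⟨1 - (2⁻¹ : ℂ) • (C + Cᴴ), ?_, ?_, ?_, ?_⟩
  · refine Matrix.PosSemidef.of_dotProduct_mulVec_nonneg (Matrix.isHermitian_one.sub hherm)
      fun x => ?_
    rw [Matrix.sub_mulVec, dotProduct_sub, hR, Matrix.one_mulVec, star_dotProduct_self,
      ← Complex.ofReal_sub, Complex.zero_le_real]
    linarith [le_abs_self (star x ⬝ᵥ (C *ᵥ x)).re, hC2 x]
  · have h2 : (2 : ℂ) • 1 - (1 - (2⁻¹ : ℂ) • (C + Cᴴ)) = 1 + (2⁻¹ : ℂ) • (C + Cᴴ) := by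
      rw [two_smul]; abel
    rw [h2]
    refine Matrix.PosSemidef.of_dotProduct_mulVec_nonneg (Matrix.isHermitian_one.add hherm)
      fun x => ?_
    rw [Matrix.add_mulVec, dotProduct_add, hR, Matrix.one_mulVec, star_dotProduct_self,
      ← Complex.ofReal_add, Complex.zero_le_real]
    linarith [neg_abs_le (star x ⬝ᵥ (C *ᵥ x)).re, hC2 x]
  · have hk : √S = k * √(entanglementFidelity J Λ) := by
      rcases Nat.eq_zero_or_pos k with h0 | h0
      · subst h0
        simp [hS, Matrix.trace]
      · have : S = (k : ℝ) ^ 2 * entanglementFidelity J Λ := by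
          rw [hFe]
          field_simp
        rw [this, Real.sqrt_mul (by positivity), Real.sqrt_sq (by positivity)]
    rw [Matrix.trace_sub, Matrix.trace_smul, Matrix.trace_add, Matrix.trace_conjTranspose, htr,
      Matrix.trace_one, hk]
    have hle : entanglementFidelity J Λ ≤ √(entanglementFidelity J Λ) :=
      Real.le_sqrt_of_sq_le (by nlinarith)
    simp
    nlinarith [Nat.cast_nonneg (α := ℝ) k]
  · intro ψ hψ
    refine le_trans ?_ (hC1 ψ)
    rw [Matrix.sub_mulVec, dotProduct_sub, hR, Matrix.one_mulVec, star_dotProduct_self, hψ,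
      ← Complex.ofReal_sub, Complex.ofReal_re]
    have := Complex.abs_re_le_norm (star ψ ⬝ᵥ (C *ᵥ ψ))
    have h3 : (star ψ ⬝ᵥ (C *ᵥ ψ)).re ^ 2 ≤ ‖star ψ ⬝ᵥ (C *ᵥ ψ)‖ ^ 2 := sq_le_sq.mpr (by simpa)
    nlinarith [sq_nonneg ((star ψ ⬝ᵥ (C *ᵥ ψ)).re - 1)]

end Defect

/-! ### From strong subspace transmission to entanglement transmission -/

section StrongToEnt

variable {S a b : Type*} [Fintype a] [DecidableEq a] [Fintype b] [DecidableEq b]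
  {N : S → Channel a b} {l k : ℕ}

lemma hasKraus_blockMap (N : S → Channel a b) (s : Fin l → S) : HasKraus (blockMap N s) :=
  HasKraus.tensorMap fun i => (N (s i)).hasKraus

lemma hasKraus_codeMap (N : S → Channel a b) {d : ℕ} (s : Fin l → S) (c : CodePair a b l k d) :
    HasKraus (codeMap N s c) :=
  c.2.hasKraus.comp ((hasKraus_blockMap N s).comp c.1.hasKraus)

lemma EntCode.integrable_entanglementFidelity (C : EntCode N l k) (s : Fin l → S) :
    MeasureTheory.Integrable (fun c => entanglementFidelity C.incl (codeMap N s c))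
      C.μ := by
  let := C.σ
  have := C.prob
  refine MeasureTheory.Integrable.of_bound
    (C.measurable_entanglementFidelity s).aestronglyMeasurable 1 (Filter.Eventually.of_forall ?_)
  intro c
  rw [Real.norm_of_nonneg ((hasKraus_codeMap N s c).entanglementFidelity_nonneg _)]
  exact (hasKraus_codeMap N s c).entanglementFidelity_le_one C.incl_isometry

lemma EntCode.integral_entanglementFidelity_nonneg (C : EntCode N l k) (s : Fin l → S) :
    0 ≤ ∫ c, entanglementFidelity C.incl (codeMap N s c) ∂C.μ :=
  MeasureTheory.integral_nonneg fun c =>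
    (hasKraus_codeMap N s c).entanglementFidelity_nonneg C.incl

lemma EntCode.performance_le (C : EntCode N l k) (s : Fin l → S) :
    C.performance ≤ ∫ c, entanglementFidelity C.incl (codeMap N s c) ∂C.μ :=
  ciInf_le ⟨0, by rintro _ ⟨s, rfl⟩; exact C.integral_entanglementFidelity_nonneg s⟩ s

lemma EntCode.performance_le_one [Nonempty S] (C : EntCode N l k) : C.performance ≤ 1 := by
  let := C.σ
  have := C.prob
  obtain ⟨s⟩ : Nonempty (Fin l → S) := inferInstance
  refine (C.performance_le s).trans ?_
  refine (MeasureTheory.integral_mono (C.integrable_entanglementFidelity s)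
    (MeasureTheory.integrable_const (1 : ℝ)) fun c =>
      (hasKraus_codeMap N s c).entanglementFidelity_le_one C.incl_isometry).trans_eq ?_
  simp

lemma sqNorm_eq_one_iff {n : ℕ} (ψ : Fin n → ℂ) :
    sqNorm ψ = 1 ↔ ‖(WithLp.toLp 2 ψ : EuclideanSpace ℂ (Fin n))‖ = 1 := by
  rw [sqNorm_eq_norm_toLp, pow_eq_one_iff_of_nonneg (norm_nonneg _) two_ne_zero]

lemma StrongCode.integrable_overlap (C : StrongCode N l k) (s : Fin l → S) {ψ : Fin k → ℂ}
    (hψ : sqNorm ψ = 1) :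
    MeasureTheory.Integrable (fun c => overlap C.incl (codeMap N s c) ψ) C.μ := by
  let := C.σ
  have := C.prob
  have hm := C.measurable_vectorFidelity s (WithLp.toLp 2 ψ) ((sqNorm_eq_one_iff ψ).mp hψ)
  simp only [fun c => vectorFidelity_eq_overlap C.incl_isometry (hasKraus_codeMap N s c) hψ] at hm
  refine MeasureTheory.Integrable.of_bound hm.aestronglyMeasurable 1
    (Filter.Eventually.of_forall ?_)
  intro c
  rw [Real.norm_of_nonneg ((hasKraus_codeMap N s c).overlap_nonneg _ _)]
  exact (hasKraus_codeMap N s c).overlap_le_one C.incl_isometry hψ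

lemma StrongCode.integral_vectorFidelity_nonneg (C : StrongCode N l k) (s : Fin l → S)
    (ψ : Fin k → ℂ) : 0 ≤ ∫ c, vectorFidelity C.incl (codeMap N s c) ψ ∂C.μ :=
  MeasureTheory.integral_nonneg fun _ => sq_nonneg _

lemma StrongCode.performance_le (C : StrongCode N l k) (s : Fin l → S) {ψ : Fin k → ℂ}
    (hψ : sqNorm ψ = 1) :
    C.performance ≤ ∫ c, overlap C.incl (codeMap N s c) ψ ∂C.μ := by
  simp only [← fun c => vectorFidelity_eq_overlap C.incl_isometry (hasKraus_codeMap N s c) hψ]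
  have hψ' : (WithLp.toLp 2 ψ : EuclideanSpace ℂ (Fin k)) ∈
      Metric.sphere (0 : EuclideanSpace ℂ (Fin k)) 1 := by
    rw [mem_sphere_zero_iff_norm]
    exact (sqNorm_eq_one_iff ψ).mp hψ
  refine (ciInf_le ⟨0, ?_⟩ s).trans (ciInf_le ⟨0, ?_⟩ (⟨_, hψ'⟩ : Metric.sphere _ _))
  · rintro _ ⟨s, rfl⟩
    exact Real.iInf_nonneg fun ψ => C.integral_vectorFidelity_nonneg s _
  · rintro _ ⟨ψ, rfl⟩
    exact C.integral_vectorFidelity_nonneg s _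

lemma StrongCode.performance_le_one [Nonempty S] (C : StrongCode N l k) : C.performance ≤ 1 := by
  let := C.σ
  have := C.prob
  obtain ⟨s⟩ : Nonempty (Fin l → S) := inferInstance
  have hψ := sqNorm_single (⟨0, C.k_pos⟩ : Fin k)
  refine (C.performance_le s hψ).trans ?_
  refine (MeasureTheory.integral_mono (C.integrable_overlap s hψ)
    (MeasureTheory.integrable_const (1 : ℝ)) fun c =>
      (hasKraus_codeMap N s c).overlap_le_one C.incl_isometry hψ).trans_eq ?_
  simp

lemma integral_pair_combination {Ω : Type*} [MeasurableSpace Ω] {μ : MeasureTheory.Measure Ω}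
    [MeasureTheory.IsProbabilityMeasure μ] {f g u v : Ω → ℝ} (hf : MeasureTheory.Integrable f μ)
    (hg : MeasureTheory.Integrable g μ) (hu : MeasureTheory.Integrable u μ)
    (hv : MeasureTheory.Integrable v μ) :
    MeasureTheory.Integrable (fun c => f c + g c - 2 + (u c + v c) / 2) μ ∧
      ∫ c, (f c + g c - 2 + (u c + v c) / 2) ∂μ =
        (∫ c, f c ∂μ) + (∫ c, g c ∂μ) - 2 + ((∫ c, u c ∂μ) + ∫ c, v c ∂μ) / 2 := by
  have hfg : MeasureTheory.Integrable (fun c => f c + g c) μ := hf.add hg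
  have huv : MeasureTheory.Integrable (fun c => u c + v c) μ := hu.add hv
  have h2 : MeasureTheory.Integrable (fun c => f c + g c - 2) μ :=
    hfg.sub (MeasureTheory.integrable_const _)
  refine ⟨h2.add (huv.div_const 2), ?_⟩
  rw [MeasureTheory.integral_add h2 (huv.div_const 2),
    MeasureTheory.integral_sub hfg (MeasureTheory.integrable_const _),
    MeasureTheory.integral_add hf hg, MeasureTheory.integral_div, MeasureTheory.integral_add hu hv]
  simp

/-- The infidelity of entanglement transmission is at most three times that of strong subspace
transmission with the same code. -/
lemma StrongCode.le_performance_toEntCode [Nonempty S] (C : StrongCode N l k) :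
    1 - 3 * (1 - C.performance) ≤ C.toEntCode.performance := by
  let := C.σ
  have := C.prob
  have hJ := C.incl_isometry
  have hp1 := C.performance_le_one
  refine le_ciInf fun s => ?_
  have hs : ∀ i : Fin k, MeasureTheory.Integrable
      (fun c => overlap C.incl (codeMap N s c) (Pi.single i 1)) C.μ := fun i =>
    C.integrable_overlap s (sqNorm_single i)
  have hsp := fun i => C.performance_le s (sqNorm_single i)
  have hone : star (1 : ℂ) = 1 := star_one ℂ
  have hneg : star (-1 : ℂ) = -1 := by simp
  have key : ∀ i j : Fin k,
      MeasureTheory.Integrable (fun c => pairBound (overlap C.incl (codeMap N s c)) i j) C.μ ∧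
      1 - 3 * (1 - C.performance) ≤
        ∫ c, pairBound (overlap C.incl (codeMap N s c)) i j ∂C.μ := by
    intro i j
    unfold pairBound
    split_ifs with hij
    · exact ⟨hs i, by linarith [hsp i]⟩
    · have hv1 := sqNorm_pairVec hij hone (one_mul 1)
      have hv2 := sqNorm_pairVec hij hneg (by norm_num)
      have i1 := C.integrable_overlap s hv1
      have i2 := C.integrable_overlap s hv2
      obtain ⟨hi, e⟩ := integral_pair_combination i1 i2 (hs i) (hs j)
      refine ⟨hi, ?_⟩
      rw [e]
      linarith [hsp i, hsp j, C.performance_le s hv1, C.performance_le s hv2]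
  have hint : MeasureTheory.Integrable (fun c => ((k : ℝ) ^ 2)⁻¹ *
      ∑ i, ∑ j, pairBound (overlap C.incl (codeMap N s c)) i j) C.μ :=
    (MeasureTheory.integrable_finsetSum _ fun i _ =>
      MeasureTheory.integrable_finsetSum _ fun j _ => (key i j).1).const_mul _
  refine le_trans ?_ (MeasureTheory.integral_mono hint (C.integrable_entanglementFidelity s)
    fun c => (hasKraus_codeMap N s c).sum_pairBound_le hJ)
  rw [MeasureTheory.integral_const_mul, MeasureTheory.integral_finsetSum _ fun i _ =>
      MeasureTheory.integrable_finsetSum _ fun j _ => (key i j).1]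
  simp only [fun i => MeasureTheory.integral_finsetSum Finset.univ
    fun j (_ : j ∈ Finset.univ) => (key i j).1]
  have hk : (0 : ℝ) < k := Nat.cast_pos.mpr C.k_pos
  rw [le_inv_mul_iff₀ (by positivity)]
  refine le_trans (le_of_eq ?_) (Finset.sum_le_sum fun i _ => Finset.sum_le_sum fun j _ =>
    (key i j).2)
  simp
  ring

lemma tendsto_performance_toEntCode [Nonempty S] {k : ℕ → ℕ} {C : ∀ l, StrongCode N l (k l)}
    (h : Filter.Tendsto (fun l => (C l).performance) Filter.atTop (nhds 1)) :
    Filter.Tendsto (fun l => (C l).toEntCode.performance) Filter.atTop (nhds 1) := by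
  refine tendsto_of_tendsto_of_tendsto_of_le_of_le ?_ tendsto_const_nhds
    (fun l => (C l).le_performance_toEntCode) (fun l => (C l).toEntCode.performance_le_one)
  have := ((h.const_sub 1).const_mul 3).const_sub 1
  simpa using this

end StrongToEnt

/-! ### Gaussian integrals of quadratic forms -/

section Gaussian

variable {ι : Type*} [Fintype ι] [DecidableEq ι]

open scoped Matrix.Norms.L2Operator in
lemma exists_eq_conjTranspose_mul {Q : Matrix ι ι ℂ} (hQ : Q.PosSemidef) :
    ∃ B : Matrix ι ι ℂ, Q = Bᴴ * B :=
  CStarAlgebra.nonneg_iff_eq_star_mul_self.mp hQ.nonneg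

omit [DecidableEq ι] in
lemma measurable_sqNorm : Measurable fun x : ι → ℂ => sqNorm x := by
  unfold sqNorm
  fun_prop

omit [DecidableEq ι] in
lemma measurable_quadForm (Q : Matrix ι ι ℂ) :
    Measurable fun x : ι → ℂ => (star x ⬝ᵥ (Q *ᵥ x)).re := by
  simp only [dotProduct, Matrix.mulVec, Pi.star_apply, Complex.star_def]
  fun_prop

omit [DecidableEq ι] in
lemma lintegral_exp_neg_sqNorm_ne_top :
    ∫⁻ x : ι → ℂ, ENNReal.ofReal (Real.exp (-sqNorm x)) ≠ ∞ := by
  have h1 : MeasureTheory.Integrable (fun z : ℂ => Real.exp (-‖z‖ ^ 2)) := by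
    have := (GaussianFourier.integrable_cexp_neg_mul_sq_norm_add (V := ℂ) (b := 1) (by simp) 0
      0).norm
    refine this.congr (Filter.Eventually.of_forall fun z => ?_)
    simp only [Complex.norm_exp]
    congr 1
    simp [← Complex.ofReal_pow]
  have h2 := MeasureTheory.Integrable.fintype_prod (ι := ι)
    (μ := fun _ => (MeasureTheory.volume : MeasureTheory.Measure ℂ)) (fun _ => h1)
  have h3 : (fun x : ι → ℂ => ∏ i, Real.exp (-‖x i‖ ^ 2)) = fun x => Real.exp (-sqNorm x) := by
    ext x
    rw [← Real.exp_sum, sqNorm, Finset.sum_neg_distrib]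
  rw [h3] at h2
  exact h2.lintegral_lt_top.ne

omit [DecidableEq ι] in
lemma lintegral_exp_neg_sqNorm_ne_zero :
    ∫⁻ x : ι → ℂ, ENNReal.ofReal (Real.exp (-sqNorm x)) ≠ 0 := by
  have hm : Measurable fun x : ι → ℂ => ENNReal.ofReal (Real.exp (-sqNorm x)) :=
    (Real.measurable_exp.comp measurable_sqNorm.neg).ennreal_ofReal
  rw [← pos_iff_ne_zero, MeasureTheory.lintegral_pos_iff_support hm]
  have : Function.support (fun x : ι → ℂ => ENNReal.ofReal (Real.exp (-sqNorm x))) = Set.univ := by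
    ext x
    simp [Real.exp_pos]
  rw [this]
  exact MeasureTheory.Measure.measure_univ_pos.mpr
    (NeZero.ne (MeasureTheory.volume : MeasureTheory.Measure (ι → ℂ)))

/-- The complex Gaussian integral of the form `Q = Bᴴ B`, by the substitution `x ↦ B x`, whose
real Jacobian is `|det B|² = det Q`. -/
lemma lintegral_exp_neg_quadForm {Q : Matrix ι ι ℂ} (hQ : Q.PosSemidef) (hdet : Q.det ≠ 0) :
    ∫⁻ x : ι → ℂ, ENNReal.ofReal (Real.exp (-(star x ⬝ᵥ (Q *ᵥ x)).re)) =
      ENNReal.ofReal (Q.det.re)⁻¹ * ∫⁻ x : ι → ℂ, ENNReal.ofReal (Real.exp (-sqNorm x)) := by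
  obtain ⟨B, rfl⟩ := exists_eq_conjTranspose_mul hQ
  let f : (ι → ℂ) →ₗ[ℝ] (ι → ℂ) := (Matrix.toLin' B).restrictScalars ℝ
  have hf : LinearMap.det f = Complex.normSq B.det := by
    rw [LinearMap.det_restrictScalars, LinearMap.det_toLin', Algebra.norm_complex_apply]
  have hd : (Bᴴ * B).det.re = Complex.normSq B.det := by
    rw [Matrix.det_mul, Matrix.det_conjTranspose, Complex.star_def, mul_comm, Complex.mul_conj,
      Complex.ofReal_re]
  have hB : B.det ≠ 0 := by
    rw [Matrix.det_mul] at hdet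
    exact right_ne_zero_of_mul hdet
  have hf0 : LinearMap.det f ≠ 0 := by
    rw [hf]
    exact (Complex.normSq_pos.mpr hB).ne'
  have hmap := MeasureTheory.Measure.map_linearMap_addHaar_eq_smul_addHaar
    (MeasureTheory.volume : MeasureTheory.Measure (ι → ℂ)) hf0
  have hfm : Measurable f := f.continuous_of_finiteDimensional.measurable
  have hm : Measurable fun x : ι → ℂ => ENNReal.ofReal (Real.exp (-sqNorm x)) :=
    (Real.measurable_exp.comp measurable_sqNorm.neg).ennreal_ofReal
  have hq : ∀ x, (star x ⬝ᵥ ((Bᴴ * B) *ᵥ x)).re = sqNorm (f x) := fun x => by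
    rw [← sqNorm_mulVec_eq, Complex.ofReal_re]
    rfl
  simp only [hq]
  rw [← MeasureTheory.lintegral_map hm hfm, hmap, MeasureTheory.lintegral_smul_measure, hf, hd,
    abs_of_nonneg (inv_nonneg.mpr (Complex.normSq_nonneg _)), smul_eq_mul]

/-- The first moment method for a Gaussian vector: if the expectations of finitely many
exponentials of quadratic forms have sum less than one, then at some point all of these
exponentials are less than one. -/
lemma exists_forall_exp_lt_one {T : Type*} [Fintype T] {Q : T → Matrix ι ι ℂ}
    (hQ : ∀ t, (Q t).PosSemidef) (hdet : ∀ t, (Q t).det ≠ 0) (w : T → ℝ) (hw : ∀ t, 0 ≤ w t)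
    (hsum : ∑ t, w t * ((Q t).det.re)⁻¹ < 1) :
    ∃ x : ι → ℂ, ∀ t, w t * Real.exp (sqNorm x - (star x ⬝ᵥ (Q t *ᵥ x)).re) < 1 := by
  by_contra! hcon
  set Z := ∫⁻ x : ι → ℂ, ENNReal.ofReal (Real.exp (-sqNorm x)) with hZ
  have hd : ∀ t, 0 ≤ (Q t).det.re := fun t =>
    (Complex.nonneg_iff.mp (hQ t).det_nonneg).1
  have hpt : ∀ x : ι → ℂ, ENNReal.ofReal (Real.exp (-sqNorm x)) ≤
      ∑ t, ENNReal.ofReal (w t) * ENNReal.ofReal (Real.exp (-(star x ⬝ᵥ (Q t *ᵥ x)).re)) := by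
    intro x
    obtain ⟨t, ht⟩ := hcon x
    refine le_trans ?_ (Finset.single_le_sum (f := fun t => ENNReal.ofReal (w t) *
      ENNReal.ofReal (Real.exp (-(star x ⬝ᵥ (Q t *ᵥ x)).re))) (fun _ _ => zero_le)
      (Finset.mem_univ t))
    rw [← ENNReal.ofReal_mul (hw t)]
    refine ENNReal.ofReal_le_ofReal ?_
    have := mul_le_mul_of_nonneg_left ht (Real.exp_pos (-sqNorm x)).le
    rw [mul_one, mul_left_comm, ← Real.exp_add] at this
    refine this.trans_eq ?_
    congr 2
    ring
  have hle : Z ≤ ENNReal.ofReal (∑ t, w t * ((Q t).det.re)⁻¹) * Z := by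
    refine (MeasureTheory.lintegral_mono hpt).trans_eq ?_
    have hm : ∀ t, Measurable fun x : ι → ℂ =>
        ENNReal.ofReal (Real.exp (-(star x ⬝ᵥ (Q t *ᵥ x)).re)) := fun t =>
      (Real.measurable_exp.comp (measurable_quadForm (Q t)).neg).ennreal_ofReal
    rw [MeasureTheory.lintegral_finsetSum _ fun t _ => (hm t).const_mul _,
      ENNReal.ofReal_sum_of_nonneg fun t _ => mul_nonneg (hw t) (inv_nonneg.mpr (hd t)),
      Finset.sum_mul]
    refine Finset.sum_congr rfl fun t _ => ?_
    rw [MeasureTheory.lintegral_const_mul _ (hm t), lintegral_exp_neg_quadForm (hQ t) (hdet t),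
      ENNReal.ofReal_mul (hw t), mul_assoc]
  have hlt : ENNReal.ofReal (∑ t, w t * ((Q t).det.re)⁻¹) * Z < 1 * Z :=
    ENNReal.mul_lt_mul_left lintegral_exp_neg_sqNorm_ne_zero lintegral_exp_neg_sqNorm_ne_top
      (by rw [← ENNReal.ofReal_one]; exact (ENNReal.ofReal_lt_ofReal_iff one_pos).mpr hsum)
  rw [one_mul] at hlt
  exact absurd hle (not_le.mpr hlt)

end Gaussian

/-! ### Random subspaces on which defect operators are small -/

section RandomSubspace

variable {k : ℕ}

lemma quadForm_le_two_mul {H : Matrix (Fin k) (Fin k) ℂ} (h2 : ((2 : ℂ) • 1 - H).PosSemidef)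
    (x : Fin k → ℂ) : (star x ⬝ᵥ (H *ᵥ x)).re ≤ 2 * sqNorm x := by
  have := (Complex.nonneg_iff.mp (h2.dotProduct_mulVec_nonneg x)).1
  rw [Matrix.sub_mulVec, Matrix.smul_mulVec, dotProduct_sub, dotProduct_smul, Matrix.one_mulVec,
    star_dotProduct_self, smul_eq_mul] at this
  simp at this
  linarith

/-- The determinant that governs the exponential moment of `⟨g, (H - δ) g⟩ / 4` for a standard
complex Gaussian vector `g`. -/
lemma exp_le_det {H : Matrix (Fin k) (Fin k) ℂ} (hH : H.PosSemidef)
    (h2 : ((2 : ℂ) • 1 - H).PosSemidef) {δ ε : ℝ} (hδ : 0 < δ) (hδ1 : δ ≤ 1) (hε : ε ≤ δ / 8)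
    (htr : H.trace.re ≤ k * ε) :
    ((((1 + δ / 4 : ℝ) : ℂ)) • 1 - (4⁻¹ : ℂ) • H : Matrix (Fin k) (Fin k) ℂ).PosSemidef ∧
    Real.exp (k * δ / 16) ≤
      (((1 + δ / 4 : ℝ) : ℂ) • 1 - (4⁻¹ : ℂ) • H : Matrix (Fin k) (Fin k) ℂ).det.re := by
  set c : ℝ := 1 + δ / 4 with hc
  set M : Matrix (Fin k) (Fin k) ℂ := (c : ℂ) • 1 - (4⁻¹ : ℂ) • H with hM
  have hMq : ∀ x, (star x ⬝ᵥ (M *ᵥ x)).re = c * sqNorm x - (star x ⬝ᵥ (H *ᵥ x)).re / 4 := by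
    intro x
    rw [hM, Matrix.sub_mulVec, Matrix.smul_mulVec, Matrix.smul_mulVec, dotProduct_sub,
      dotProduct_smul, dotProduct_smul, Matrix.one_mulVec, star_dotProduct_self, smul_eq_mul,
      smul_eq_mul, ← Complex.ofReal_mul, Complex.sub_re, Complex.ofReal_re]
    congr 1
    rw [show (4⁻¹ : ℂ) = ((4⁻¹ : ℝ) : ℂ) by push_cast; rfl, Complex.re_ofReal_mul]
    ring
  have hH0 : ∀ x, 0 ≤ (star x ⬝ᵥ (H *ᵥ x)).re := fun x =>
    (Complex.nonneg_iff.mp (hH.dotProduct_mulVec_nonneg x)).1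
  have hH2 := quadForm_le_two_mul h2
  have hMh : M.IsHermitian := by
    rw [Matrix.IsHermitian, hM, Matrix.conjTranspose_sub, Matrix.conjTranspose_smul,
      Matrix.conjTranspose_smul, hH.isHermitian, Matrix.conjTranspose_one]
    simp
  have hbasis : ∀ i, sqNorm (hMh.eigenvectorBasis i).ofLp = 1 := fun i => by
    rw [sqNorm_eq_norm_toLp]
    simp
  have hev : ∀ i, hMh.eigenvalues i = c -
      (star (hMh.eigenvectorBasis i).ofLp ⬝ᵥ (H *ᵥ (hMh.eigenvectorBasis i).ofLp)).re / 4 := by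
    intro i
    rw [hMh.eigenvalues_eq]
    change (star (hMh.eigenvectorBasis i).ofLp ⬝ᵥ (M *ᵥ (hMh.eigenvectorBasis i).ofLp)).re = _
    rw [hMq, hbasis, mul_one]
  have hle : ∀ i, hMh.eigenvalues i ≤ c := fun i => by
    rw [hev]; linarith [hH0 (hMh.eigenvectorBasis i).ofLp]
  have hge : ∀ i, c / 2 ≤ hMh.eigenvalues i := fun i => by
    have := hH2 (hMh.eigenvectorBasis i).ofLp
    rw [hbasis] at this
    rw [hev]
    linarith
  have hc0 : 0 < c := by positivity
  have hpos : ∀ i, 0 < hMh.eigenvalues i := fun i => by linarith [hge i]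
  refine ⟨hMh.posSemidef_iff_eigenvalues_nonneg.mpr fun i => (hpos i).le, ?_⟩
  have htrM : ∑ i, hMh.eigenvalues i = k * c - H.trace.re / 4 := by
    have h := congrArg Complex.re hMh.trace_eq_sum_eigenvalues
    rw [Complex.re_sum] at h
    simp only [RCLike.ofReal_eq_complex_ofReal, Complex.ofReal_re] at h
    rw [← h, hM, Matrix.trace_sub, Matrix.trace_smul, Matrix.trace_smul, Matrix.trace_one]
    rw [show (4⁻¹ : ℂ) = ((4⁻¹ : ℝ) : ℂ) by push_cast; rfl]
    simp only [Complex.sub_re, smul_eq_mul, Complex.re_ofReal_mul, Fintype.card_fin,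
      Complex.natCast_re]
    ring
  -- `log u ≥ 2 (u - 1)` for `u` between `1 / 2` and `1`
  have hlog : ∀ i, Real.log c + 2 * (hMh.eigenvalues i / c - 1) ≤ Real.log (hMh.eigenvalues i) := by
    intro i
    have hu1 : hMh.eigenvalues i / c ≤ 1 := (div_le_one hc0).mpr (hle i)
    have hu2 : 1 / 2 ≤ hMh.eigenvalues i / c := by
      rw [le_div_iff₀ hc0]; linarith [hge i]
    set u := hMh.eigenvalues i / c with hu
    have hu0 : 0 < u := by linarith
    have h3 := Real.one_sub_inv_le_log_of_pos hu0
    have h4 : Real.log (hMh.eigenvalues i) = Real.log c + Real.log u := by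
      rw [← Real.log_mul hc0.ne' hu0.ne', hu, mul_div_cancel₀ _ hc0.ne']
    have h5 : 2 * (u - 1) ≤ 1 - u⁻¹ := by
      have h6 : u⁻¹ ≤ 2 := by
        rw [inv_le_comm₀ hu0 two_pos]; linarith
      have h7 : u * u⁻¹ = 1 := mul_inv_cancel₀ hu0.ne'
      nlinarith
    linarith
  have hlogc : δ / 8 ≤ Real.log c := by
    refine le_trans ?_ (Real.one_sub_inv_le_log_of_pos hc0)
    have h7 : c * c⁻¹ = 1 := mul_inv_cancel₀ hc0.ne'
    have h8 : c⁻¹ ≤ 1 := inv_le_one_of_one_le₀ (by linarith)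
    have h9 : 0 < c⁻¹ := inv_pos.mpr hc0
    nlinarith
  have hlogsum : k * δ / 16 ≤ ∑ i, Real.log (hMh.eigenvalues i) := by
    refine le_trans ?_ (Finset.sum_le_sum fun i _ => hlog i)
    rw [Finset.sum_add_distrib, ← Finset.mul_sum, Finset.sum_sub_distrib, ← Finset.sum_div, htrM]
    simp only [Finset.sum_const, Finset.card_univ, Fintype.card_fin, nsmul_eq_mul, mul_one]
    have h10 : (k * c - H.trace.re / 4) / c - k = -(H.trace.re / 4) / c := by
      field_simp
      ring
    rw [h10]
    have hk : (0 : ℝ) ≤ k := Nat.cast_nonneg k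
    have h11 : H.trace.re / 4 / c ≤ k * δ / 32 := by
      rw [div_le_iff₀ hc0]
      have h12 : 0 ≤ k * δ / 32 * (δ / 4) := by positivity
      have h13 : k * ε ≤ k * (δ / 8) := mul_le_mul_of_nonneg_left hε hk
      rw [hc]
      linarith
    rw [neg_div]
    nlinarith
  have hdet : M.det.re = ∏ i, hMh.eigenvalues i := by
    rw [hMh.det_eq_prod_eigenvalues]
    simp only [RCLike.ofReal_eq_complex_ofReal]
    rw [← Complex.ofReal_prod, Complex.ofReal_re]
  rw [hdet, ← Finset.prod_congr rfl fun i _ => Real.exp_log (hpos i), ← Real.exp_sum]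
  exact Real.exp_le_exp.mpr hlogsum

end RandomSubspace

section RandomSubspaceExistence

variable {k D : ℕ}

/-- The matrix of the map `X ↦ X x`, where the `k × D` matrix `X` is read as a vector. -/
def evalMatrix (k : ℕ) (x : Fin D → ℂ) : Matrix (Fin k) (Fin k × Fin D) ℂ :=
  Matrix.of fun i p => if i = p.1 then x p.2 else 0

lemma evalMatrix_mulVec (x : Fin D → ℂ) (X : Fin k × Fin D → ℂ) :
    evalMatrix k x *ᵥ X = (Matrix.of fun i j => X (i, j)) *ᵥ x := by
  ext i
  simp only [evalMatrix, Matrix.mulVec, dotProduct, Matrix.of_apply, Fintype.sum_prod_type, ite_mul,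
    zero_mul]
  rw [Finset.sum_comm]
  simp [mul_comm]

lemma evalMatrix_mul_conjTranspose {x : Fin D → ℂ} (hx : sqNorm x = 1) :
    evalMatrix k x * (evalMatrix k x)ᴴ = 1 := by
  have h : ∑ j, x j * star (x j) = 1 := by
    have := star_dotProduct_self x
    rw [hx, dotProduct_comm] at this
    simpa [dotProduct] using this
  ext i i'
  simp only [Matrix.mul_apply, evalMatrix, Matrix.of_apply, Matrix.conjTranspose_apply,
    Fintype.sum_prod_type]
  rw [Finset.sum_comm]
  by_cases hi : i = i'
  · subst hi
    simpa [apply_ite star] using h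
  · simp [apply_ite star, hi, Matrix.one_apply_ne hi]

/-- The form `1 - Lᴴ L + Lᴴ M L`, for a coisometry `L`, is positive and has the determinant
of `M`. -/
lemma coisometry_extension {ι κ : Type*} [Fintype ι] [DecidableEq ι] [Fintype κ] [DecidableEq κ]
    {L : Matrix κ ι ℂ} (hL : L * Lᴴ = 1) {M : Matrix κ κ ℂ} (hM : M.PosSemidef) :
    (1 - Lᴴ * L + Lᴴ * M * L).PosSemidef ∧ (1 - Lᴴ * L + Lᴴ * M * L).det = M.det := by
  constructor
  · have h1 : (1 - Lᴴ * L)ᴴ * (1 - Lᴴ * L) = 1 - Lᴴ * L := by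
      rw [Matrix.conjTranspose_sub, Matrix.conjTranspose_one, Matrix.conjTranspose_mul,
        Matrix.conjTranspose_conjTranspose, Matrix.sub_mul, Matrix.mul_sub, Matrix.mul_sub,
        Matrix.one_mul, Matrix.mul_one, Matrix.one_mul, Matrix.mul_assoc Lᴴ L,
        ← Matrix.mul_assoc L, hL, Matrix.one_mul, sub_self, sub_zero]
    rw [← h1]
    exact (Matrix.posSemidef_conjTranspose_mul_self _).add (hM.conjTranspose_mul_mul_same L)
  · have h2 : 1 - Lᴴ * L + Lᴴ * M * L = 1 - Lᴴ * ((1 - M) * L) := by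
      rw [Matrix.sub_mul, Matrix.mul_sub, Matrix.one_mul, Matrix.mul_assoc]
      abel
    rw [h2, Matrix.det_one_sub_mul_comm, Matrix.mul_assoc, hL, Matrix.mul_one, sub_sub_cancel]

lemma sqNorm_mulVec_le_of_entries (X : Fin k × Fin D → ℂ) (x : Fin D → ℂ) :
    sqNorm ((Matrix.of fun i j => X (i, j)) *ᵥ x) ≤ sqNorm X * sqNorm x := by
  unfold sqNorm
  rw [Fintype.sum_prod_type, Finset.sum_mul]
  refine Finset.sum_le_sum fun i _ => ?_
  simp only [Matrix.mulVec, dotProduct, Matrix.of_apply]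
  refine (pow_le_pow_left₀ (norm_nonneg _) (norm_sum_le _ _) 2).trans ?_
  simp only [norm_mul]
  exact Finset.sum_mul_sq_le_sq_mul_sq _ _ _

/-- If `⟨X x, H_t X x⟩ < δ ‖X x‖²` for all unit vectors `x`, then orthonormalizing the columns of
`X` gives an isometry on whose range `H_t ≤ δ`. -/
lemma exists_isometry_of_matrix {T : Type*} [Nonempty T] {H : T → Matrix (Fin k) (Fin k) ℂ}
    {δ : ℝ} (X : Matrix (Fin k) (Fin D) ℂ)
    (hX : ∀ t x, sqNorm x = 1 →
      (star (X *ᵥ x) ⬝ᵥ (H t *ᵥ (X *ᵥ x))).re < δ * sqNorm (X *ᵥ x)) :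
    ∃ V : Matrix (Fin k) (Fin D) ℂ, Vᴴ * V = 1 ∧ ∀ t x, sqNorm x = 1 →
      (star (V *ᵥ x) ⬝ᵥ (H t *ᵥ (V *ᵥ x))).re ≤ δ := by
  have hX' : ∀ t x, x ≠ 0 →
      (star (X *ᵥ x) ⬝ᵥ (H t *ᵥ (X *ᵥ x))).re < δ * sqNorm (X *ᵥ x) := by
    intro t x hx
    obtain ⟨c, u, hc, hu, rfl⟩ := exists_unit_smul hx
    rw [Matrix.mulVec_smul, quadForm_smul, sqNorm_smul, mul_left_comm]
    exact mul_lt_mul_of_pos_left (hX t u hu) (by positivity)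
  obtain ⟨t₀⟩ := ‹Nonempty T›
  have hinj : ∀ x, X *ᵥ x = 0 → x = 0 := by
    intro x hx
    by_contra h
    have := hX' t₀ x h
    rw [hx] at this
    simp [sqNorm] at this
  obtain ⟨B, hB⟩ := exists_eq_conjTranspose_mul (Matrix.posSemidef_conjTranspose_mul_self X)
  have hdet : IsUnit B.det := by
    rw [isUnit_iff_ne_zero]
    intro h0
    obtain ⟨v, hv, hBv⟩ := Matrix.exists_mulVec_eq_zero_iff.mpr h0
    refine hv (hinj v ?_)
    have h1 := sqNorm_mulVec_eq X v
    rw [hB, ← sqNorm_mulVec_eq, hBv] at h1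
    have h2 : sqNorm (X *ᵥ v) = sqNorm (0 : Fin D → ℂ) := by exact_mod_cast h1
    rw [← sqNorm_eq_zero, h2]
    simp [sqNorm]
  have hV : (X * B⁻¹)ᴴ * (X * B⁻¹) = 1 := by
    rw [Matrix.conjTranspose_mul, Matrix.mul_assoc, ← Matrix.mul_assoc Xᴴ, hB,
      Matrix.mul_assoc, Matrix.mul_nonsing_inv _ hdet, Matrix.mul_one, ← Matrix.conjTranspose_mul,
      Matrix.mul_nonsing_inv _ hdet, Matrix.conjTranspose_one]
  refine ⟨X * B⁻¹, hV, fun t x hx => ?_⟩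
  have hx0 : B⁻¹ *ᵥ x ≠ 0 := by
    intro h
    have h1 := sqNorm_mulVec_of_isometry hV x
    rw [← Matrix.mulVec_mulVec, h, hx] at h1
    simp [sqNorm] at h1
  have h1 := (hX' t _ hx0).le
  rwa [Matrix.mulVec_mulVec, sqNorm_mulVec_of_isometry hV, hx, mul_one] at h1

/-- Passing from a point of the net to a nearby unit vector. -/
lemma quadForm_perturb {H : Matrix (Fin k) (Fin k) ℂ} (hH : H.PosSemidef)
    (h2 : ((2 : ℂ) • 1 - H).PosSemidef) {δ r η : ℝ} (hδ : 0 ≤ δ) (hδ1 : δ ≤ 1)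
    {y z : Fin k → ℂ} (hy : √(sqNorm y) ≤ r) (hz : √(sqNorm z) ≤ r)
    (hyz : √(sqNorm (y - z)) ≤ η) :
    (star y ⬝ᵥ (H *ᵥ y)).re - δ * sqNorm y ≤
      (star z ⬝ᵥ (H *ᵥ z)).re - δ * sqNorm z + 6 * r * η := by
  obtain ⟨B, hB⟩ := exists_eq_conjTranspose_mul hH
  have hq : ∀ x, (star x ⬝ᵥ (H *ᵥ x)).re = √(sqNorm (B *ᵥ x)) ^ 2 := fun x => by
    rw [Real.sq_sqrt (sqNorm_nonneg _), hB, ← sqNorm_mulVec_eq, Complex.ofReal_re]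
  have hb : ∀ x, √(sqNorm (B *ᵥ x)) ^ 2 ≤ 2 * √(sqNorm x) ^ 2 := fun x => by
    rw [← hq, Real.sq_sqrt (sqNorm_nonneg x)]
    exact quadForm_le_two_mul h2 x
  have h2' : (√2 : ℝ) ^ 2 = 2 := Real.sq_sqrt zero_le_two
  have hb' : ∀ x, √(sqNorm (B *ᵥ x)) ≤ √2 * √(sqNorm x) := fun x => by
    refine (abs_le_of_sq_le_sq' ?_ (by positivity)).2
    rw [mul_pow, h2']
    exact hb x
  rw [hq, hq, ← Real.sq_sqrt (sqNorm_nonneg y), ← Real.sq_sqrt (sqNorm_nonneg z)]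
  have t1 := sqrt_sqNorm_sub_le (B *ᵥ y) (B *ᵥ z)
  rw [← Matrix.mulVec_sub] at t1
  have t2 := sqrt_sqNorm_sub_le z y
  rw [sqNorm_sub_comm] at t2
  have b1 := hb' y
  have b2 := hb' z
  have b3 := hb' (y - z)
  have hs : (0 : ℝ) ≤ √2 := Real.sqrt_nonneg 2
  have n1 := Real.sqrt_nonneg (sqNorm (B *ᵥ y))
  have n2 := Real.sqrt_nonneg (sqNorm (B *ᵥ z))
  have n3 := Real.sqrt_nonneg (sqNorm (B *ᵥ (y - z)))
  have n4 := Real.sqrt_nonneg (sqNorm y)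
  have n5 := Real.sqrt_nonneg (sqNorm z)
  have n6 := Real.sqrt_nonneg (sqNorm (y - z))
  generalize √(sqNorm (B *ᵥ y)) = p at *
  generalize √(sqNorm (B *ᵥ z)) = q at *
  generalize √(sqNorm (B *ᵥ (y - z))) = e at *
  generalize √(sqNorm y) = p' at *
  generalize √(sqNorm z) = q' at *
  generalize √(sqNorm (y - z)) = e' at *
  have hr : 0 ≤ r := n4.trans hy
  have hη : 0 ≤ η := n6.trans hyz
  have c1 : p ≤ √2 * r := b1.trans (by gcongr)
  have c2 : q ≤ √2 * r := b2.trans (by gcongr)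
  have c3 : e ≤ √2 * η := b3.trans (by gcongr)
  have d1 : p ^ 2 - q ^ 2 ≤ 4 * r * η := by
    have : (p - q) * (p + q) ≤ (√2 * η) * (√2 * r + √2 * r) := by
      apply mul_le_mul <;> linarith
    nlinarith
  have d2 : q' ^ 2 - p' ^ 2 ≤ 2 * r * η := by
    have : (q' - p') * (q' + p') ≤ η * (r + r) := by
      apply mul_le_mul <;> linarith
    nlinarith
  have d3 : δ * (q' ^ 2 - p' ^ 2) ≤ 2 * r * η :=
    (mul_le_mul_of_nonneg_left d2 hδ).trans (mul_le_of_le_one_left (by positivity) hδ1)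
  linarith

/-- A Gaussian random subspace of dimension `D` is nearly annihilated by finitely many defect
operators of small trace, as long as their number and the size of a net of the unit sphere
of `ℂ^D` are at most exponential in `k`. -/
theorem exists_isometry_quadForm_le {T : Type*} [Fintype T] [Nonempty T] (hk : 0 < k) (hD : 0 < D)
    {H : T → Matrix (Fin k) (Fin k) ℂ} (hH : ∀ t, (H t).PosSemidef)
    (h2 : ∀ t, ((2 : ℂ) • 1 - H t).PosSemidef) {δ ε : ℝ} (hδ : 0 < δ) (hδ1 : δ ≤ 1)
    (hε : ε ≤ δ / 8) (htr : ∀ t, (H t).trace.re ≤ k * ε) (net : Finset (Fin D → ℂ))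
    (hunit : ∀ x ∈ net, sqNorm x = 1)
    (hnet : ∀ x, sqNorm x = 1 → ∃ y ∈ net, √(sqNorm (x - y)) ≤ δ / (256 * D))
    (hcard : (Fintype.card T : ℝ) * net.card ≤ Real.exp (k * δ / 32) / 2) :
    ∃ V : Matrix (Fin k) (Fin D) ℂ, Vᴴ * V = 1 ∧ ∀ t x, sqNorm x = 1 →
      (star (V *ᵥ x) ⬝ᵥ (H t *ᵥ (V *ᵥ x))).re ≤ δ := by
  have hk' : (1 : ℝ) ≤ k := by exact_mod_cast hk
  have hD' : (1 : ℝ) ≤ D := by exact_mod_cast hD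
  have hkD : (1 : ℝ) ≤ k * D := one_le_mul_of_one_le_of_one_le hk' hD'
  let M : T → Matrix (Fin k) (Fin k) ℂ := fun t => ((1 + δ / 4 : ℝ) : ℂ) • 1 - (4⁻¹ : ℂ) • H t
  have hM := fun t => exp_le_det (hH t) (h2 t) hδ hδ1 hε (htr t)
  let L : net → Matrix (Fin k) (Fin k × Fin D) ℂ := fun x => evalMatrix k x.1
  have hL : ∀ x, L x * (L x)ᴴ = 1 := fun x => evalMatrix_mul_conjTranspose (hunit x.1 x.2)
  -- the forms for the pairs of a defect operator and a point of the net, and for the norm of `X`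
  let Q : Option (T × net) → Matrix (Fin k × Fin D) (Fin k × Fin D) ℂ := fun o =>
    o.elim ((2⁻¹ : ℂ) • 1) fun p => 1 - (L p.2)ᴴ * L p.2 + (L p.2)ᴴ * M p.1 * L p.2
  -- the weight of the norm form excludes `‖X‖² ≥ 4kD`, and the other weights exclude
  -- `⟨X x, (H_t - δ) X x⟩ ≥ -kδ/8`
  let w : Option (T × net) → ℝ := fun o =>
    o.elim (Real.exp (-(2 * (k * D)))) fun _ => Real.exp (k * δ / 32)
  have hQ : ∀ o, (Q o).PosSemidef := by
    rintro (_ | ⟨t, x⟩)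
    · refine Matrix.PosSemidef.one.smul ?_
      rw [show (2⁻¹ : ℂ) = ((2⁻¹ : ℝ) : ℂ) by push_cast; rfl, Complex.zero_le_real]
      norm_num
    · exact (coisometry_extension (hL x) (hM t).1).1
  have hQdet0 : (Q none).det = (((2 : ℝ)⁻¹ ^ (k * D) : ℝ) : ℂ) := by
    change ((2⁻¹ : ℂ) • (1 : Matrix (Fin k × Fin D) (Fin k × Fin D) ℂ)).det = _
    rw [Matrix.det_smul, Matrix.det_one]
    simp
  have hQdet1 : ∀ t x, (Q (some (t, x))).det = (M t).det := fun t x =>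
    (coisometry_extension (hL x) (hM t).1).2
  have hdet : ∀ o, (Q o).det ≠ 0 := by
    rintro (_ | ⟨t, x⟩)
    · rw [hQdet0]
      exact_mod_cast (by positivity : (0 : ℝ) < (2 : ℝ)⁻¹ ^ (k * D)).ne'
    · rw [hQdet1]
      intro h0
      have h1 := (hM t).2
      change _ ≤ (M t).det.re at h1
      rw [h0, Complex.zero_re] at h1
      exact absurd h1 (not_le.mpr (Real.exp_pos _))
  have hsum : ∑ o, w o * ((Q o).det.re)⁻¹ < 1 := by
    rw [Fintype.sum_option]
    have h1 : w none * ((Q none).det.re)⁻¹ < 1 / 2 := by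
      rw [hQdet0, Complex.ofReal_re, inv_pow, inv_inv]
      change Real.exp (-(2 * (k * D))) * _ < _
      have e0 : (2 : ℝ) ^ (k * D) ≤ Real.exp (k * D) := by
        have := pow_le_pow_left₀ (by norm_num) (show (2 : ℝ) ≤ Real.exp 1 by
          linarith [Real.add_one_le_exp 1]) (k * D)
        rwa [← Real.exp_nat_mul, mul_one, Nat.cast_mul] at this
      calc Real.exp (-(2 * (k * D))) * 2 ^ (k * D)
          ≤ Real.exp (-(2 * (k * D))) * Real.exp (k * D) := by gcongr
        _ = Real.exp (-(k * D)) := by rw [← Real.exp_add]; congr 1; ring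
        _ ≤ Real.exp (-1) := Real.exp_le_exp.mpr (by linarith)
        _ < 1 / 2 := by
          rw [Real.exp_neg, one_div, inv_lt_inv₀ (Real.exp_pos 1) two_pos]
          linarith [Real.add_one_lt_exp (one_ne_zero (α := ℝ))]
    have h3 : ∑ p : T × net, w (some p) * ((Q (some p)).det.re)⁻¹ ≤ 1 / 2 := by
      have h4 : ∀ p : T × net, w (some p) * ((Q (some p)).det.re)⁻¹ ≤
          Real.exp (-(k * δ / 32)) := by
        rintro ⟨t, x⟩
        rw [hQdet1]
        change Real.exp (k * δ / 32) * _ ≤ _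
        calc Real.exp (k * δ / 32) * ((M t).det.re)⁻¹
            ≤ Real.exp (k * δ / 32) * (Real.exp (k * δ / 16))⁻¹ := by
              gcongr
              exact (hM t).2
          _ = Real.exp (-(k * δ / 32)) := by
            rw [← Real.exp_neg, ← Real.exp_add]; congr 1; ring
      refine (Finset.sum_le_sum fun p _ => h4 p).trans ?_
      rw [Finset.sum_const, Finset.card_univ, Fintype.card_prod, Fintype.card_coe, nsmul_eq_mul,
        Nat.cast_mul]
      refine (mul_le_mul_of_nonneg_right hcard (Real.exp_pos _).le).trans_eq ?_
      rw [div_mul_eq_mul_div, ← Real.exp_add, add_neg_cancel, Real.exp_zero]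
    linarith
  obtain ⟨X, hX⟩ := exists_forall_exp_lt_one hQ hdet w
    (by rintro (_ | _) <;> exact (Real.exp_pos _).le) hsum
  have hXnorm : sqNorm X ≤ 4 * (k * D) := by
    have h := hX none
    change Real.exp (-(2 * (k * D))) * Real.exp (sqNorm X -
      (star X ⬝ᵥ (((2⁻¹ : ℂ) • (1 : Matrix (Fin k × Fin D) (Fin k × Fin D) ℂ)) *ᵥ X)).re) < 1 at h
    rw [← Real.exp_add, Real.exp_lt_one_iff, Matrix.smul_mulVec, Matrix.one_mulVec, dotProduct_smul,
      star_dotProduct_self, smul_eq_mul, show (2⁻¹ : ℂ) = ((2⁻¹ : ℝ) : ℂ) by push_cast; rfl,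
      ← Complex.ofReal_mul, Complex.ofReal_re] at h
    linarith
  let X' : Matrix (Fin k) (Fin D) ℂ := Matrix.of fun i j => X (i, j)
  have hXnet : ∀ t, ∀ z ∈ net, (star (X' *ᵥ z) ⬝ᵥ (H t *ᵥ (X' *ᵥ z))).re -
      δ * sqNorm (X' *ᵥ z) < -(k * δ / 8) := by
    intro t z hz
    have h := hX (some (t, ⟨z, hz⟩))
    change Real.exp (k * δ / 32) * Real.exp (sqNorm X - (star X ⬝ᵥ ((1 - (evalMatrix k z)ᴴ *
      evalMatrix k z + (evalMatrix k z)ᴴ * M t * evalMatrix k z) *ᵥ X)).re) < 1 at h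
    have hform : (star X ⬝ᵥ ((1 - (evalMatrix k z)ᴴ * evalMatrix k z + (evalMatrix k z)ᴴ * M t *
        evalMatrix k z) *ᵥ X)).re = sqNorm X - sqNorm (X' *ᵥ z) +
        ((1 + δ / 4) * sqNorm (X' *ᵥ z) - (star (X' *ᵥ z) ⬝ᵥ (H t *ᵥ (X' *ᵥ z))).re / 4) := by
      rw [Matrix.add_mulVec, Matrix.sub_mulVec, dotProduct_add, dotProduct_sub, Matrix.one_mulVec,
        star_dotProduct_self, ← sqNorm_mulVec_eq, Matrix.mul_assoc, ← Matrix.mulVec_mulVec,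
        ← star_mulVec_dotProduct, ← Matrix.mulVec_mulVec, evalMatrix_mulVec]
      change (_ - _ + star (X' *ᵥ z) ⬝ᵥ (M t *ᵥ (X' *ᵥ z))).re = _
      rw [Complex.add_re, Complex.sub_re, Complex.ofReal_re, Complex.ofReal_re]
      congr 1
      rw [Matrix.sub_mulVec, Matrix.smul_mulVec, Matrix.smul_mulVec, dotProduct_sub,
        dotProduct_smul, dotProduct_smul, Matrix.one_mulVec, star_dotProduct_self, smul_eq_mul,
        smul_eq_mul, ← Complex.ofReal_mul, Complex.sub_re, Complex.ofReal_re]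
      congr 1
      rw [show (4⁻¹ : ℂ) = ((4⁻¹ : ℝ) : ℂ) by push_cast; rfl, Complex.re_ofReal_mul]
      ring
    rw [hform, ← Real.exp_add, Real.exp_lt_one_iff] at h
    linarith
  refine exists_isometry_of_matrix X' fun t x hx => ?_
  obtain ⟨z, hz, hxz⟩ := hnet x hx
  have hr : ∀ y, √(sqNorm (X' *ᵥ y)) ≤ √(4 * (k * D)) * √(sqNorm y) := fun y => by
    rw [← Real.sqrt_mul (by positivity)]
    exact Real.sqrt_le_sqrt ((sqNorm_mulVec_le_of_entries X y).trans
      (mul_le_mul_of_nonneg_right hXnorm (sqNorm_nonneg y)))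
  have hx1 := hr x
  have hz1 := hr z
  rw [hx, Real.sqrt_one, mul_one] at hx1
  rw [hunit z hz, Real.sqrt_one, mul_one] at hz1
  have hxz1 : √(sqNorm (X' *ᵥ x - X' *ᵥ z)) ≤ √(4 * (k * D)) * (δ / (256 * D)) := by
    rw [← Matrix.mulVec_sub]
    exact (hr _).trans (mul_le_mul_of_nonneg_left hxz (Real.sqrt_nonneg _))
  have h := quadForm_perturb (hH t) (h2 t) hδ.le hδ1 hx1 hz1 hxz1
  have h3 := hXnet t z hz
  have h4 : 6 * √(4 * (k * D)) * (√(4 * (k * D)) * (δ / (256 * D))) = 24 * (k * δ) / 256 := by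
    have : √(4 * (k * D : ℝ)) * √(4 * (k * D)) = 4 * (k * D) := Real.mul_self_sqrt (by positivity)
    calc 6 * √(4 * (k * D)) * (√(4 * (k * D)) * (δ / (256 * D)))
        = 6 * (√(4 * (k * D : ℝ)) * √(4 * (k * D))) * (δ / (256 * D)) := by ring
      _ = _ := by rw [this]; field_simp; ring
  rw [h4] at h
  have : 0 < k * δ := by positivity
  linarith

end RandomSubspaceExistence

/-! ### Finite nets -/

section Nets

/-- A net of a family of points of the unit cube with respect to the maximum norm: one member for
each occupied cell of a grid of width `1 / m`. -/
lemma exists_finset_net {T ι : Type*} [Fintype ι] (f : T → ι → ℝ) (hf : ∀ t i, |f t i| ≤ 1)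
    {m : ℕ} (hm : 0 < m) :
    ∃ T₀ : Finset T, T₀.card ≤ (2 * m + 1) ^ Fintype.card ι ∧
      ∀ t, ∃ t₀ ∈ T₀, ∀ i, |f t i - f t₀ i| ≤ 1 / m := by
  classical
  rcases isEmpty_or_nonempty T with hT | hT
  · exact ⟨∅, by simp, fun t => hT.elim t⟩
  have hm' : (0 : ℝ) < m := Nat.cast_pos.mpr hm
  let g : T → ι → ℤ := fun t i => ⌊f t i * m⌋
  let cells : Finset (ι → ℤ) := Fintype.piFinset fun _ => Finset.Icc (-(m : ℤ)) m
  have hg : ∀ t, g t ∈ cells := by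
    intro t
    refine Fintype.mem_piFinset.mpr fun i => Finset.mem_Icc.mpr ⟨?_, ?_⟩
    · refine Int.le_floor.mpr ?_
      push_cast
      nlinarith [(abs_le.mp (hf t i)).1]
    · have h1 : f t i * m ≤ m := by nlinarith [(abs_le.mp (hf t i)).2]
      have h2 : ((⌊f t i * m⌋ : ℤ) : ℝ) ≤ ((m : ℤ) : ℝ) := by
        push_cast
        exact (Int.floor_le _).trans h1
      exact_mod_cast h2
  refine ⟨cells.image (Function.invFun g), Finset.card_image_le.trans ?_, fun t =>
    ⟨Function.invFun g (g t), Finset.mem_image_of_mem _ (hg t), fun i => ?_⟩⟩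
  · rw [show cells.card = _ from Fintype.card_piFinset _, Finset.prod_const, Int.card_Icc,
      Finset.card_univ]
    apply le_of_eq
    congr 1
    omega
  · have h : g (Function.invFun g (g t)) = g t := Function.invFun_eq ⟨t, rfl⟩
    have h' : ⌊f (Function.invFun g (g t)) i * m⌋ = ⌊f t i * m⌋ := congrFun h i
    have h1 := Int.abs_sub_lt_one_of_floor_eq_floor h'.symm
    rw [← sub_mul, abs_mul, abs_of_pos hm'] at h1
    rw [le_div_iff₀ hm']
    exact h1.le

lemma exists_finset_net_complex {T ι : Type*} [Fintype ι] (f : T → ι → ℂ)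
    (hf : ∀ t i, ‖f t i‖ ≤ 1) {m : ℕ} (hm : 0 < m) :
    ∃ T₀ : Finset T, T₀.card ≤ (2 * m + 1) ^ (2 * Fintype.card ι) ∧
      ∀ t, ∃ t₀ ∈ T₀, ∀ i, ‖f t i - f t₀ i‖ ≤ 2 / m := by
  obtain ⟨T₀, hcard, hnet⟩ := exists_finset_net
    (fun t (p : Bool × ι) => if p.1 then (f t p.2).re else (f t p.2).im) (fun t p => by
      split_ifs
      · exact (Complex.abs_re_le_norm _).trans (hf t p.2)
      · exact (Complex.abs_im_le_norm _).trans (hf t p.2)) hm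
  refine ⟨T₀, by simpa [Fintype.card_prod] using hcard, fun t => ?_⟩
  obtain ⟨t₀, ht₀, h⟩ := hnet t
  refine ⟨t₀, ht₀, fun i => (Complex.norm_le_abs_re_add_abs_im _).trans ?_⟩
  have h1 := h (true, i)
  have h2 := h (false, i)
  simp only [if_true, Bool.false_eq_true, if_false] at h1 h2
  rw [Complex.sub_re, Complex.sub_im]
  calc _ ≤ 1 / (m : ℝ) + 1 / m := add_le_add h1 h2
    _ = 2 / m := by ring

/-- A net of the unit sphere of `ℂ^D` that consists of unit vectors. -/
lemma exists_sphere_net {D m : ℕ} (hD : 0 < D) (hm : 0 < m) :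
    ∃ net : Finset (Fin D → ℂ), net.card ≤ (2 * m + 1) ^ (2 * D) ∧ (∀ x ∈ net, sqNorm x = 1) ∧
      ∀ x, sqNorm x = 1 → ∃ y ∈ net, √(sqNorm (x - y)) ≤ 2 * D / m := by
  classical
  obtain ⟨T₀, hcard, hnet⟩ := exists_finset_net_complex
    (fun (x : {x : Fin D → ℂ // sqNorm x = 1}) i => x.1 i) (fun x i => by
      have h1 := Finset.single_le_sum (f := fun i => ‖x.1 i‖ ^ 2) (fun _ _ => by positivity)
        (Finset.mem_univ i)
      have h2 : ‖x.1 i‖ ^ 2 ≤ 1 := h1.trans_eq x.2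
      exact (abs_le_of_sq_le_sq' (by simpa using h2) zero_le_one).2) hm
  refine ⟨T₀.image Subtype.val, Finset.card_image_le.trans (by simpa using hcard), ?_, ?_⟩
  · intro x hx
    obtain ⟨y, _, rfl⟩ := Finset.mem_image.mp hx
    exact y.2
  · intro x hx
    obtain ⟨y, hy, h⟩ := hnet ⟨x, hx⟩
    refine ⟨y.1, Finset.mem_image_of_mem _ hy, Real.sqrt_le_iff.mpr ⟨by positivity, ?_⟩⟩
    have hD' : (1 : ℝ) ≤ D := by exact_mod_cast hD
    calc sqNorm (x - y.1) ≤ ∑ _i : Fin D, (2 / (m : ℝ)) ^ 2 :=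
          Finset.sum_le_sum fun i _ => pow_le_pow_left₀ (norm_nonneg _) (h i) 2
      _ = D * (2 / (m : ℝ)) ^ 2 := by simp
      _ ≤ D ^ 2 * (2 / (m : ℝ)) ^ 2 := by
          gcongr
          nlinarith
      _ = (2 * D / m) ^ 2 := by ring

end Nets

/-! ### Continuity in the channels -/

section Continuity

variable {a b : Type*} [Fintype a] [DecidableEq a] [Fintype b] [DecidableEq b]

lemma norm_sum_mul_star_le_one {n : Type*} [Fintype n] {x y : n → ℂ} (hx : sqNorm x ≤ 1)
    (hy : sqNorm y ≤ 1) : ‖∑ j, x j * star (y j)‖ ≤ 1 := by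
  have h := norm_star_dotProduct_le y x
  rw [dotProduct_comm] at h
  refine h.trans (mul_le_one₀ ?_ (Real.sqrt_nonneg _) ?_) <;> rw [Real.sqrt_le_one] <;> assumption

omit [DecidableEq b] in
lemma HasKraus.norm_map_proj_apply_le {Λ : Matrix a a ℂ →ₗ[ℂ] Matrix b b ℂ} (h : HasKraus Λ)
    {ψ : a → ℂ} (hψ : sqNorm ψ = 1) (u v : b) : ‖Λ (proj ψ) u v‖ ≤ 1 := by
  obtain ⟨n, A, hA⟩ := h
  have h1 : Λ (proj ψ) u v = ∑ j, (A j *ᵥ ψ) u * star ((A j *ᵥ ψ) v) := by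
    rw [hA.1, Matrix.sum_apply]
    simp only [← proj_mulVec]
    rfl
  have h2 : ∀ w, sqNorm (fun j => (A j *ᵥ ψ) w) ≤ 1 := fun w => by
    rw [← hψ, ← hA.sum_sqNorm_mulVec ψ]
    exact Finset.sum_le_sum fun j _ => norm_sq_le_sqNorm _ w
  rw [h1]
  exact norm_sum_mul_star_le_one (h2 u) (h2 v)

omit [DecidableEq b] in
lemma HasKraus.norm_map_single_apply_le {Λ : Matrix a a ℂ →ₗ[ℂ] Matrix b b ℂ} (h : HasKraus Λ)
    (p q : a) (u v : b) : ‖Λ (Matrix.single p q 1) u v‖ ≤ 1 := by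
  obtain ⟨n, A, hA⟩ := h
  rw [kraus_single_apply hA]
  have h2 : ∀ p w, sqNorm (fun j => A j w p) ≤ 1 := fun p w => by
    rw [← sqNorm_single p, ← hA.sum_sqNorm_mulVec]
    refine Finset.sum_le_sum fun j _ => ?_
    rw [Matrix.mulVec_single_one]
    exact norm_sq_le_sqNorm ((A j).col p) w
  exact norm_sum_mul_star_le_one (h2 p u) (h2 q v)

omit [DecidableEq b] in
/-- The linear form `Y ↦ ⟨φ, Λ(Y) φ⟩` has matrix elements of modulus at most one. -/
lemma HasKraus.norm_dotProduct_map_mulVec_le {Λ : Matrix a a ℂ →ₗ[ℂ] Matrix b b ℂ}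
    (h : HasKraus Λ) {φ : b → ℂ} (hφ : sqNorm φ = 1) (Y : Matrix a a ℂ) :
    ‖star φ ⬝ᵥ (Λ Y *ᵥ φ)‖ ≤ ∑ p, ∑ q, ‖Y p q‖ := by
  obtain ⟨n, A, hA⟩ := h
  have h1 : ∀ p, sqNorm (fun j => star φ ⬝ᵥ (A j *ᵥ Pi.single p 1)) ≤ 1 := fun p => by
    rw [← sqNorm_single p, ← hA.sum_sqNorm_mulVec]
    refine Finset.sum_le_sum fun j _ => ?_
    have := norm_star_dotProduct_sq_le φ (A j *ᵥ Pi.single p 1)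
    rwa [hφ, one_mul] at this
  have h2 : ∀ j p, star φ ⬝ᵥ (A j *ᵥ Pi.single p 1) = ∑ u, star (φ u) * A j u p := fun j p => by
    rw [Matrix.mulVec_single_one]
    rfl
  have h3 : star φ ⬝ᵥ (Λ Y *ᵥ φ) = ∑ p, ∑ q, Y p q *
      ∑ j, (star φ ⬝ᵥ (A j *ᵥ Pi.single p 1)) * star (star φ ⬝ᵥ (A j *ᵥ Pi.single q 1)) := by
    have h4 : ∀ j, star φ ⬝ᵥ ((A j * Y * (A j)ᴴ) *ᵥ φ) = ∑ p, ∑ q, Y p q *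
        ((star φ ⬝ᵥ (A j *ᵥ Pi.single p 1)) * star (star φ ⬝ᵥ (A j *ᵥ Pi.single q 1))) := by
      intro j
      have e1 : ∀ p, star (star φ ⬝ᵥ (A j *ᵥ Pi.single p 1)) = ((A j)ᴴ *ᵥ φ) p := fun p => by
        rw [h2, star_sum]
        simp [Matrix.mulVec, dotProduct, mul_comm]
      have e2 : ∀ p, (star φ ⬝ᵥ (A j *ᵥ Pi.single p 1)) = star (((A j)ᴴ *ᵥ φ) p) := fun p => by
        rw [← e1, star_star]
      rw [Matrix.mul_assoc, ← Matrix.mulVec_mulVec]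
      have e3 := star_mulVec_dotProduct (A j)ᴴ φ ((Y * (A j)ᴴ) *ᵥ φ)
      rw [Matrix.conjTranspose_conjTranspose] at e3
      rw [← e3, ← Matrix.mulVec_mulVec]
      simp only [e2, star_star]
      generalize (A j)ᴴ *ᵥ φ = z
      simp only [dotProduct, Matrix.mulVec, Pi.star_apply, Finset.mul_sum]
      exact Finset.sum_congr rfl fun p _ => Finset.sum_congr rfl fun q _ => by ring
    rw [hA.1, Matrix.sum_mulVec, dotProduct_sum]
    simp only [h4, Finset.mul_sum]
    rw [Finset.sum_comm]
    exact Finset.sum_congr rfl fun p _ => Finset.sum_comm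
  rw [h3]
  refine (norm_sum_le _ _).trans (Finset.sum_le_sum fun p _ => (norm_sum_le _ _).trans
    (Finset.sum_le_sum fun q _ => ?_))
  rw [norm_mul]
  exact mul_le_of_le_one_right (norm_nonneg _) (norm_sum_mul_star_le_one (h1 p) (h1 q))

lemma norm_prod_sub_prod_le {ι : Type*} (s : Finset ι) {f g : ι → ℂ} (hf : ∀ i, ‖f i‖ ≤ 1)
    (hg : ∀ i, ‖g i‖ ≤ 1) : ‖∏ i ∈ s, f i - ∏ i ∈ s, g i‖ ≤ ∑ i ∈ s, ‖f i - g i‖ := by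
  classical
  induction s using Finset.induction_on with
  | empty => simp
  | insert i s hi ih =>
    rw [Finset.prod_insert hi, Finset.prod_insert hi, Finset.sum_insert hi]
    have h1 : ‖∏ i ∈ s, f i‖ ≤ 1 := by
      rw [norm_prod]
      exact Finset.prod_le_one (fun _ _ => norm_nonneg _) fun j _ => hf j
    calc ‖f i * ∏ i ∈ s, f i - g i * ∏ i ∈ s, g i‖
        = ‖(f i - g i) * ∏ i ∈ s, f i + g i * (∏ i ∈ s, f i - ∏ i ∈ s, g i)‖ := by
          congr 1; ring
      _ ≤ ‖f i - g i‖ * ‖∏ i ∈ s, f i‖ + ‖g i‖ * ‖∏ i ∈ s, f i - ∏ i ∈ s, g i‖ := by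
          refine (norm_add_le _ _).trans ?_
          rw [norm_mul, norm_mul]
      _ ≤ ‖f i - g i‖ * 1 + 1 * ∑ i ∈ s, ‖f i - g i‖ := by
          gcongr
          exact hg i
      _ = _ := by ring

variable {S : Type*} {l k d : ℕ}

/-- If the channels `N (s i)` and `N (t i)` have nearly the same matrix elements, then the overlaps
for the state sequences `s` and `t` are nearly the same. -/
lemma overlap_codeMap_sub_le (N : S → Channel a b) {s t : Fin l → S} {η : ℝ}
    (hst : ∀ i p q u v, ‖(N (s i)).lin (Matrix.single p q 1) u v -
      (N (t i)).lin (Matrix.single p q 1) u v‖ ≤ η)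
    {J : Matrix (Fin d) (Fin k) ℂ} (hJ : Jᴴ * J = 1) (c : CodePair a b l k d) {ψ : Fin k → ℂ}
    (hψ : sqNorm ψ = 1) :
    |overlap J (codeMap N s c) ψ - overlap J (codeMap N t c) ψ| ≤
      ((Fintype.card a * Fintype.card b) ^ 2 : ℕ) ^ l * (l * η) := by
  have hφ : sqNorm (J *ᵥ ψ) = 1 := by rw [sqNorm_mulVec_of_isometry hJ, hψ]
  set ρ := c.1.lin (proj ψ) with hρ
  have h1 : overlap J (codeMap N s c) ψ - overlap J (codeMap N t c) ψ =
      (star (J *ᵥ ψ) ⬝ᵥ (c.2.lin (blockMap N s ρ - blockMap N t ρ) *ᵥ (J *ᵥ ψ))).re := by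
    rw [map_sub, Matrix.sub_mulVec, dotProduct_sub, Complex.sub_re]
    rfl
  rw [h1]
  refine (Complex.abs_re_le_norm _).trans
    ((c.2.hasKraus.norm_dotProduct_map_mulVec_le hφ _).trans ?_)
  have h2 : ∀ y y', ‖(blockMap N s ρ - blockMap N t ρ) y y'‖ ≤
      ∑ _x : Fin l → a, ∑ _x' : Fin l → a, l * η := by
    intro y y'
    have e : (blockMap N s ρ - blockMap N t ρ) y y' = ∑ x, ∑ x', ρ x x' *
        (∏ i, (N (s i)).lin (Matrix.single (x i) (x' i) 1) (y i) (y' i) -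
          ∏ i, (N (t i)).lin (Matrix.single (x i) (x' i) 1) (y i) (y' i)) := by
      simp only [mul_sub, Finset.sum_sub_distrib]
      rfl
    rw [e]
    refine (norm_sum_le _ _).trans (Finset.sum_le_sum fun x _ => (norm_sum_le _ _).trans
      (Finset.sum_le_sum fun x' _ => ?_))
    rw [norm_mul]
    refine (mul_le_of_le_one_left (norm_nonneg _)
      (c.1.hasKraus.norm_map_proj_apply_le hψ x x')).trans ?_
    refine (norm_prod_sub_prod_le _ (fun i => (N (s i)).hasKraus.norm_map_single_apply_le _ _ _ _)
      fun i => (N (t i)).hasKraus.norm_map_single_apply_le _ _ _ _).trans ?_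
    refine (Finset.sum_le_sum fun i _ => hst i _ _ _ _).trans_eq ?_
    simp
  refine (Finset.sum_le_sum fun y _ => Finset.sum_le_sum fun y' _ => h2 y y').trans_eq ?_
  simp only [Finset.sum_const, Finset.card_univ, Fintype.card_fun, Fintype.card_fin, nsmul_eq_mul]
  push_cast
  ring

end Continuity

/-! ### Finitely supported codes -/

section FiniteCodes

variable {S a b : Type*} [Fintype a] [DecidableEq a] [Fintype b] [DecidableEq b]
  {N : S → Channel a b} {l k D d : ℕ}

lemma integral_eq_of_measure_singleton {Ω : Type*} [MeasurableSpace Ω] {μ : MeasureTheory.Measure Ω}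
    [MeasureTheory.IsProbabilityMeasure μ] {c : Ω} (hc : MeasurableSet {c}) (h : μ {c} = 1)
    (f : Ω → ℝ) : ∫ x, f x ∂μ = f c := by
  have h0 : μ {c}ᶜ = 0 := (MeasureTheory.prob_compl_eq_zero_iff hc).mpr h
  have hae : f =ᵐ[μ] fun _ => f c := by
    rw [Filter.EventuallyEq, MeasureTheory.ae_iff]
    refine MeasureTheory.measure_mono_null (fun x hx => ?_) h0
    intro hxc
    exact hx (by rw [Set.mem_singleton_iff.mp hxc])
  rw [MeasureTheory.integral_congr_ae hae]
  simp

/-- For finitely many state sequences, a random code can be replaced by a finitely supported one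
up to an arbitrarily small loss, since an integral lies in the closed convex hull of the values of
the integrand. A deterministic code is already supported in one point. -/
lemma EntCode.exists_finite_average (C : EntCode N l k) (T : Finset (Fin l → S)) {ε : ℝ}
    (hε : 0 < ε) :
    ∃ (n : ℕ) (w : Fin n → ℝ) (c : Fin n → CodePair a b l k C.d), (∀ i, 0 ≤ w i) ∧
      ∑ i, w i = 1 ∧ (C.IsDeterministic → n = 1) ∧ ∀ t ∈ T,
        C.performance - ε ≤ ∑ i, w i * entanglementFidelity C.incl (codeMap N t (c i)) := by
  let := C.σ
  have := C.prob
  by_cases hdet : C.IsDeterministic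
  · obtain ⟨c, hc, -⟩ := hdet
    refine ⟨1, fun _ => 1, fun _ => c, fun _ => zero_le_one, by simp, fun _ => rfl, fun t _ => ?_⟩
    have h := C.performance_le t
    rw [integral_eq_of_measure_singleton (C.singleton_mem c) hc] at h
    simp only [Finset.univ_unique, one_mul, Finset.sum_const, Finset.card_singleton, one_smul]
    linarith
  · let f : CodePair a b l k C.d → (T → ℝ) := fun c t =>
      entanglementFidelity C.incl (codeMap N t.1 c)
    have hf : MeasureTheory.Integrable f C.μ :=
      MeasureTheory.Integrable.of_eval fun t => C.integrable_entanglementFidelity t.1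
    have hmem : ∫ c, f c ∂C.μ ∈ closure (convexHull ℝ (Set.range f)) :=
      (convex_convexHull ℝ _).closure.integral_mem isClosed_closure
        (Filter.Eventually.of_forall fun c =>
          subset_closure (subset_convexHull ℝ _ (Set.mem_range_self c))) hf
    obtain ⟨y, hy, hdist⟩ := Metric.mem_closure_iff.mp hmem ε hε
    obtain ⟨ι, _, w, z, hw, hw1, hz, hwz⟩ := mem_convexHull_iff_exists_fintype.mp hy
    choose c hc using hz
    let e := Fintype.equivFin ι
    refine ⟨Fintype.card ι, w ∘ e.symm, c ∘ e.symm, fun i => hw _, ?_,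
      fun h => absurd h hdet, fun t ht => ?_⟩
    · rw [← hw1]
      exact e.symm.sum_comp w
    · have h1 : ∑ i, (w ∘ e.symm) i *
          entanglementFidelity C.incl (codeMap N t ((c ∘ e.symm) i)) = y ⟨t, ht⟩ := by
        have := e.symm.sum_comp fun i => w i * entanglementFidelity C.incl (codeMap N t (c i))
        refine this.trans ?_
        rw [← hwz, Finset.sum_apply]
        simp only [← hc]
        rfl
      have h2 : (∫ c, f c ∂C.μ) ⟨t, ht⟩ =
          ∫ c, entanglementFidelity C.incl (codeMap N t c) ∂C.μ :=
        MeasureTheory.eval_integral (f := f) (fun i => hf.eval i) ⟨t, ht⟩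
      have h3 := (dist_le_pi_dist (∫ c, f c ∂C.μ) y ⟨t, ht⟩).trans_lt hdist
      rw [h2, Real.dist_eq] at h3
      rw [h1]
      linarith [C.performance_le t, (abs_lt.mp h3).2]

lemma entanglementFidelity_sum {n : ℕ} (J : Matrix (Fin d) (Fin k) ℂ) (w : Fin n → ℝ)
    (Λ : Fin n → (Matrix (Fin k) (Fin k) ℂ →ₗ[ℂ] Matrix (Fin d) (Fin d) ℂ)) :
    entanglementFidelity J (∑ i, ((w i : ℝ) : ℂ) • Λ i) =
      ∑ i, w i * entanglementFidelity J (Λ i) := by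
  have h : ∀ X, idTensor (Fin k) (∑ i, ((w i : ℝ) : ℂ) • Λ i) X =
      ∑ i, ((w i : ℝ) : ℂ) • idTensor (Fin k) (Λ i) X := by
    intro X
    ext p q
    simp [idTensor, LinearMap.sum_apply, Matrix.sum_apply]
  simp only [entanglementFidelity, h, Matrix.sum_mulVec, dotProduct_sum, Matrix.smul_mulVec,
    dotProduct_smul, Complex.re_sum, smul_eq_mul, Complex.re_ofReal_mul]

lemma overlap_sum {n : ℕ} (J : Matrix (Fin d) (Fin k) ℂ) (w : Fin n → ℝ)
    (Λ : Fin n → (Matrix (Fin k) (Fin k) ℂ →ₗ[ℂ] Matrix (Fin d) (Fin d) ℂ)) (ψ : Fin k → ℂ) :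
    overlap J (∑ i, ((w i : ℝ) : ℂ) • Λ i) ψ = ∑ i, w i * overlap J (Λ i) ψ := by
  simp only [overlap, LinearMap.sum_apply, LinearMap.smul_apply, Matrix.sum_mulVec, dotProduct_sum,
    Matrix.smul_mulVec, dotProduct_smul, Complex.re_sum, smul_eq_mul, Complex.re_ofReal_mul]

/-- The code on the subspace `V ℂ^D` of the code space that uses the encoder-decoder pair `c i` with
probability `w i`. -/
lemma exists_strongCode_of_subspace {n : ℕ} {w : Fin n → ℝ} {c : Fin n → CodePair a b l k d}
    (hw : ∀ i, 0 ≤ w i) (hw1 : ∑ i, w i = 1) {J : Matrix (Fin d) (Fin k) ℂ} (hJ : Jᴴ * J = 1)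
    {V : Matrix (Fin k) (Fin D) ℂ} (hV : Vᴴ * V = 1) (hD : 0 < D) :
    ∃ C : StrongCode N l D, (n = 1 → C.toEntCode.IsDeterministic) ∧
      ∀ [Nonempty S] (p : ℝ), (∀ s ψ, sqNorm ψ = 1 →
        p ≤ ∑ i, w i * overlap J (codeMap N s (c i)) (V *ᵥ ψ)) → p ≤ C.performance := by
  have hP : ∀ i, ∃ P : Channel (Fin D) (Fin l → a), P.lin = (c i).1.lin ∘ₗ conjMap V := fun i =>
    ((c i).1.hasKraus.comp (hasKraus_conjMap hV)).exists_channel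
  choose P hP using hP
  let c' : Fin n → CodePair a b l D d := fun i => (P i, (c i).2)
  have hJV : (J * V)ᴴ * (J * V) = 1 := by
    rw [Matrix.conjTranspose_mul, Matrix.mul_assoc, ← Matrix.mul_assoc Jᴴ, hJ, Matrix.one_mul, hV]
  let σ : MeasurableSpace (CodePair a b l D d) := ⊤
  let μ : MeasureTheory.Measure (CodePair a b l D d) :=
    ∑ i, ENNReal.ofReal (w i) • MeasureTheory.Measure.dirac (c' i)
  have hμ : MeasureTheory.IsProbabilityMeasure μ := by
    constructor
    simp only [μ, MeasureTheory.Measure.coe_finsetSum, Finset.sum_apply,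
      MeasureTheory.Measure.smul_apply, MeasureTheory.measure_univ, smul_eq_mul, mul_one]
    rw [← ENNReal.ofReal_sum_of_nonneg fun i _ => hw i, hw1, ENNReal.ofReal_one]
  have hint : ∀ f : CodePair a b l D d → ℝ, ∫ x, f x ∂μ = ∑ i, w i * f (c' i) := by
    intro f
    rw [MeasureTheory.integral_finsetSum_measure]
    · refine Finset.sum_congr rfl fun i _ => ?_
      rw [MeasureTheory.integral_smul_measure, MeasureTheory.integral_dirac,
        ENNReal.toReal_ofReal (hw i), smul_eq_mul]
    · intro i _
      exact (MeasureTheory.integrable_dirac (by simp)).smul_measure ENNReal.ofReal_ne_top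
  refine ⟨{ d := d, k_pos := hD, incl := J * V, incl_isometry := hJV, σ := ⊤,
            singleton_mem := fun _ => MeasurableSpace.measurableSet_top,
            measurable_entanglementFidelity := fun _ => measurable_from_top,
            μ := μ, prob := hμ,
            measurable_vectorFidelity := fun _ _ _ => measurable_from_top }, ?_, ?_⟩
  · rintro rfl
    have h1 : w 0 = 1 := by simpa using hw1
    have hμ1 : μ = MeasureTheory.Measure.dirac (c' 0) := by simp [μ, h1]
    refine ⟨c' 0, ?_, fun A hA hc => ?_⟩
    · change μ {c' 0} = 1
      rw [hμ1]
      simp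
    · change μ A = 0
      rw [hμ1, MeasureTheory.Measure.dirac_apply' _ hA]
      simp [hc]
  · intro hS p hp
    obtain ⟨i₀⟩ : Nonempty (Fin D) := ⟨⟨0, hD⟩⟩
    have : Nonempty (Metric.sphere (0 : EuclideanSpace ℂ (Fin D)) 1) :=
      ⟨⟨WithLp.toLp 2 (Pi.single i₀ 1), by
        rw [mem_sphere_zero_iff_norm]
        exact (sqNorm_eq_one_iff _).mp (sqNorm_single i₀)⟩⟩
    refine le_ciInf fun s => le_ciInf fun ψ => ?_
    have hψ : sqNorm ψ.1.ofLp = 1 := by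
      rw [sqNorm_eq_one_iff]
      simp
    refine (hp s _ hψ).trans_eq ?_
    change _ = ∫ x, vectorFidelity (J * V) (codeMap N s x) ψ.1.ofLp ∂μ
    rw [hint]
    refine Finset.sum_congr rfl fun i _ => ?_
    rw [vectorFidelity_eq_overlap hJV (hasKraus_codeMap N s _) hψ]
    congr 1
    have hcode : codeMap N s (c' i) (proj ψ.1.ofLp) =
        codeMap N s (c i) (proj (V *ᵥ ψ.1.ofLp)) := by
      change (c i).2.lin (blockMap N s ((P i).lin _)) = (c i).2.lin (blockMap N s ((c i).1.lin _))
      rw [hP, proj_mulVec]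
      rfl
    rw [overlap, overlap, hcode, Matrix.mulVec_mulVec]

/-- The construction of a strong subspace transmission code from an entanglement transmission
code. The number `m₁` controls the net of channels, `m₂` the net of the new code space. Of the loss
`3 δ`, the defect operators account for `2 δ` and the net of channels for `δ`. -/
lemma EntCode.exists_strongCode [Nonempty S] (C : EntCode N l k) {δ : ℝ} (hδ : 0 < δ) (hδ1 : δ ≤ 1)
    (hperf : 1 - δ / 16 ≤ C.performance) (hD : 0 < D) {m₁ m₂ : ℕ} (hm₁ : 0 < m₁) (hm₂ : 0 < m₂)
    (h₁ : 2 * l * ((Fintype.card a * Fintype.card b) ^ 2 : ℕ) ^ l / δ ≤ m₁)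
    (h₂ : 512 * (D : ℝ) ^ 2 / δ ≤ m₂)
    (hcard : (2 * m₁ + 1 : ℝ) ^ (2 * (Fintype.card a * Fintype.card b) ^ 2 * l) *
      (2 * m₂ + 1) ^ (2 * D) ≤ Real.exp (k * δ / 32) / 2) :
    ∃ C' : StrongCode N l D, (C.IsDeterministic → C'.toEntCode.IsDeterministic) ∧
      1 - 3 * δ ≤ C'.performance := by
  classical
  have hJ := C.incl_isometry
  have hm₁' : (0 : ℝ) < m₁ := Nat.cast_pos.mpr hm₁
  have hm₂' : (0 : ℝ) < m₂ := Nat.cast_pos.mpr hm₂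
  have hD' : (0 : ℝ) < D := Nat.cast_pos.mpr hD
  obtain ⟨S₀, hS₀, hSnet⟩ := exists_finset_net_complex
    (fun (s : S) (p : (a × a) × (b × b)) => (N s).lin (Matrix.single p.1.1 p.1.2 1) p.2.1 p.2.2)
    (fun s p => (N s).hasKraus.norm_map_single_apply_le _ _ _ _) hm₁
  let T : Finset (Fin l → S) := Fintype.piFinset fun _ => S₀
  have hTcard : T.card ≤ (2 * m₁ + 1) ^ (2 * (Fintype.card a * Fintype.card b) ^ 2 * l) := by
    rw [show T.card = _ from Fintype.card_piFinset_const _ _, pow_mul]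
    refine (Nat.pow_le_pow_left hS₀ l).trans_eq ?_
    congr 2
    simp only [Fintype.card_prod]
    ring
  have hTnet : ∀ s : Fin l → S, ∃ t ∈ T, ∀ i p q u v, ‖(N (s i)).lin (Matrix.single p q 1) u v -
      (N (t i)).lin (Matrix.single p q 1) u v‖ ≤ 2 / m₁ := by
    intro s
    choose t ht hst using fun i => hSnet (s i)
    exact ⟨t, Fintype.mem_piFinset.mpr ht, fun i p q u v => hst i ((p, q), (u, v))⟩
  obtain ⟨n, w, c, hw, hw1, hdet, hFe⟩ := C.exists_finite_average T (show 0 < δ / 16 by positivity)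
  let Λ : (Fin l → S) → (Matrix (Fin k) (Fin k) ℂ →ₗ[ℂ] Matrix (Fin C.d) (Fin C.d) ℂ) := fun t =>
    ∑ i, ((w i : ℝ) : ℂ) • codeMap N t (c i)
  have hΛ : ∀ t, HasKraus (Λ t) := fun t =>
    HasKraus.convex_sum hw hw1 fun i => hasKraus_codeMap N t (c i)
  have hdefect : ∀ t : T, ∃ H : Matrix (Fin k) (Fin k) ℂ, H.PosSemidef ∧
      ((2 : ℂ) • 1 - H).PosSemidef ∧ H.trace.re ≤ k * (δ / 8) ∧
      ∀ ψ, sqNorm ψ = 1 → 1 - 2 * (star ψ ⬝ᵥ (H *ᵥ ψ)).re ≤ overlap C.incl (Λ t.1) ψ := by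
    intro t
    refine (hΛ t.1).exists_defect hJ ?_
    rw [entanglementFidelity_sum]
    linarith [hFe t.1 t.2]
  choose H hH0 hH2 hHtr hHψ using hdefect
  obtain ⟨net, hnetcard, hunit, hnet⟩ := exists_sphere_net hD hm₂
  obtain ⟨s₀⟩ : Nonempty (Fin l → S) := inferInstance
  have : Nonempty T := by
    obtain ⟨t, ht, -⟩ := hTnet s₀
    exact ⟨⟨t, ht⟩⟩
  obtain ⟨V, hV, hVH⟩ := exists_isometry_quadForm_le C.k_pos hD hH0 hH2 hδ hδ1 le_rfl hHtr net
    hunit (fun x hx => by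
      obtain ⟨y, hy, hxy⟩ := hnet x hx
      refine ⟨y, hy, hxy.trans ?_⟩
      rw [div_le_iff₀ hδ] at h₂
      rw [div_le_div_iff₀ hm₂' (by positivity)]
      nlinarith)
    (by
      refine le_trans ?_ hcard
      rw [Fintype.card_coe]
      refine mul_le_mul ?_ ?_ (Nat.cast_nonneg _) (by positivity)
      · exact_mod_cast hTcard
      · exact_mod_cast hnetcard)
  obtain ⟨C', hC'det, hC'⟩ := exists_strongCode_of_subspace (N := N) (c := c) hw hw1 hJ hV hD
  refine ⟨C', fun h => hC'det (hdet h), hC' _ fun s ψ hψ => ?_⟩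
  obtain ⟨t, ht, hst⟩ := hTnet s
  have hVψ : sqNorm (V *ᵥ ψ) = 1 := by rw [sqNorm_mulVec_of_isometry hV, hψ]
  have h1 := hHψ ⟨t, ht⟩ (V *ᵥ ψ) hVψ
  have h2 := hVH ⟨t, ht⟩ ψ hψ
  rw [overlap_sum] at h1
  have h3 : ∑ i, w i * (overlap C.incl (codeMap N t (c i)) (V *ᵥ ψ) - δ) ≤
      ∑ i, w i * overlap C.incl (codeMap N s (c i)) (V *ᵥ ψ) := by
    refine Finset.sum_le_sum fun i _ => mul_le_mul_of_nonneg_left ?_ (hw i)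
    have h4 := overlap_codeMap_sub_le N hst hJ (c i) hVψ
    have h5 : (((Fintype.card a * Fintype.card b) ^ 2 : ℕ) : ℝ) ^ l * (l * (2 / m₁)) ≤ δ := by
      rw [div_le_iff₀ hδ] at h₁
      calc _ = (2 * l * (((Fintype.card a * Fintype.card b) ^ 2 : ℕ) : ℝ) ^ l) / m₁ := by ring
        _ ≤ δ := by
          rw [div_le_iff₀ hm₁']
          linarith
    linarith [(abs_le.mp (h4.trans h5)).1]
  simp only [mul_sub, Finset.sum_sub_distrib, ← Finset.sum_mul, hw1] at h3
  linarith

/-- A code of dimension one that is deterministic if `C` is, without any demand on its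
performance. -/
lemma EntCode.exists_strongCode_one (C : EntCode N l k) :
    ∃ C' : StrongCode N l 1, C.IsDeterministic → C'.toEntCode.IsDeterministic := by
  obtain ⟨n, w, c, hw, hw1, hdet, -⟩ := C.exists_finite_average ∅ one_pos
  let V : Matrix (Fin k) (Fin 1) ℂ := Matrix.of fun i _ => if i = ⟨0, C.k_pos⟩ then 1 else 0
  have hV : Vᴴ * V = 1 := by
    ext i j
    rw [Subsingleton.elim i j]
    simp [V, Matrix.mul_apply]
  obtain ⟨C', hC', -⟩ := exists_strongCode_of_subspace (N := N) (c := c) hw hw1 C.incl_isometry hV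
    one_pos
  exact ⟨C', fun h => hC' (hdet h)⟩

end FiniteCodes

/-! ### Asymptotics -/

section Asymptotics

lemma mul_pow_le_pow_succ {x y : ℝ} (hx : 1 ≤ x) (hy : 1 ≤ y) (l : ℕ) :
    x * y ^ l ≤ (x * y) ^ (l + 1) := by
  rw [mul_pow]
  exact mul_le_mul (le_self_pow₀ hx (Nat.succ_ne_zero l)) (pow_le_pow_right₀ hy (Nat.le_succ l))
    (by positivity) (by positivity)

lemma pow_le_exp_log_mul {x E : ℝ} (hx : 0 ≤ x) (hE : 0 < E) {l : ℕ} (h : x ≤ E ^ (l + 1))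
    (n : ℕ) : x ^ n ≤ Real.exp (n * ((l + 1) * Real.log E)) := by
  refine (pow_le_pow_left₀ hx h n).trans_eq ?_
  rw [← pow_mul, ← Real.exp_log (pow_pos hE ((l + 1) * n)), Real.log_pow]
  congr 1
  push_cast
  ring

lemma two_rpow_mul (l : ℕ) (R : ℝ) : (2 : ℝ) ^ ((l : ℝ) * R) = ((2 : ℝ) ^ R) ^ l := by
  rw [mul_comm, Real.rpow_mul zero_le_two, Real.rpow_natCast]

/-- Resolutions of the two nets that are sufficient and grow at most exponentially. The bases come
from `2 m + 1 ≤ 2 x + 5` for `m = ⌈x⌉ + 1`, where `x` is the required lower bound of `m`. -/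
lemma exists_resolutions {δ B : ℝ} (hδ : 0 < δ) (hδ1 : δ ≤ 1) (hB1 : 1 ≤ B) (K l : ℕ) {D : ℕ}
    (hD : (D : ℝ) ≤ 2 * B ^ l) :
    ∃ m₁ m₂ : ℕ, 0 < m₁ ∧ 0 < m₂ ∧ 2 * l * (K : ℝ) ^ l / δ ≤ m₁ ∧ 512 * (D : ℝ) ^ 2 / δ ≤ m₂ ∧
      (2 * m₁ + 1 : ℝ) ≤ (9 / δ * (2 * (K + 1))) ^ (l + 1) ∧
      (2 * m₂ + 1 : ℝ) ≤ (4101 / δ * B ^ 2) ^ (l + 1) := by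
  have hδi : 1 ≤ 1 / δ := by rwa [le_div_iff₀ hδ, one_mul]
  have h9 : 1 ≤ 9 / δ := by
    rw [le_div_iff₀ hδ]; linarith
  have h4101 : 1 ≤ 4101 / δ := by
    rw [le_div_iff₀ hδ]; linarith
  have hK : (0 : ℝ) ≤ K := Nat.cast_nonneg K
  have hK1 : (1 : ℝ) ≤ 2 * (K + 1) := by linarith
  have hB2 : 1 ≤ B ^ 2 := one_le_pow₀ hB1
  have hKl : (l : ℝ) * K ^ l ≤ (2 * (K + 1)) ^ l := by
    rw [mul_pow]
    refine mul_le_mul ?_ (pow_le_pow_left₀ hK (by linarith) l) (by positivity) (by positivity)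
    exact_mod_cast Nat.lt_two_pow_self.le
  have hm₁ := Nat.ceil_lt_add_one (show 0 ≤ 2 * l * (K : ℝ) ^ l / δ by positivity)
  have hm₂ := Nat.ceil_lt_add_one (show 0 ≤ 512 * (D : ℝ) ^ 2 / δ by positivity)
  refine ⟨⌈2 * l * (K : ℝ) ^ l / δ⌉₊ + 1, ⌈512 * (D : ℝ) ^ 2 / δ⌉₊ + 1, Nat.succ_pos _,
    Nat.succ_pos _, ?_, ?_, ?_, ?_⟩
  · push_cast
    linarith [Nat.le_ceil (2 * l * (K : ℝ) ^ l / δ)]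
  · push_cast
    linarith [Nat.le_ceil (512 * (D : ℝ) ^ 2 / δ)]
  · refine le_trans ?_ (mul_pow_le_pow_succ h9 hK1 l)
    push_cast
    have h1 : 2 * l * (K : ℝ) ^ l / δ ≤ 2 * (1 / δ) * (2 * (K + 1)) ^ l := by
      calc _ = 2 * (1 / δ) * (l * (K : ℝ) ^ l) := by ring
        _ ≤ _ := by gcongr
    have h2 : 1 ≤ (1 / δ) * (2 * ((K : ℝ) + 1)) ^ l :=
      one_le_mul_of_one_le_of_one_le hδi (one_le_pow₀ hK1)
    have h3 : 9 / δ * (2 * ((K : ℝ) + 1)) ^ l = 9 * (1 / δ * (2 * ((K : ℝ) + 1)) ^ l) := by ring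
    rw [h3]
    linarith
  · refine le_trans ?_ (mul_pow_le_pow_succ h4101 hB2 l)
    push_cast
    have h1 : 512 * (D : ℝ) ^ 2 / δ ≤ 2048 * (1 / δ * (B ^ 2) ^ l) := by
      have : (D : ℝ) ^ 2 ≤ 4 * (B ^ 2) ^ l := by
        calc (D : ℝ) ^ 2 ≤ (2 * B ^ l) ^ 2 := pow_le_pow_left₀ (by positivity) hD 2
          _ = 4 * (B ^ 2) ^ l := by rw [← pow_mul, mul_pow, ← pow_mul, mul_comm l 2]; norm_num
      calc 512 * (D : ℝ) ^ 2 / δ ≤ 512 * (4 * (B ^ 2) ^ l) / δ := by gcongr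
        _ = _ := by ring
    have h2 : 1 ≤ (1 / δ) * (B ^ 2) ^ l := one_le_mul_of_one_le_of_one_le hδi (one_le_pow₀ hB2)
    have h3 : 4101 / δ * (B ^ 2) ^ l = 4101 * (1 / δ * (B ^ 2) ^ l) := by ring
    rw [h3]
    linarith

/-- The nets that are needed for a code space of dimension `⌈2^(l R')⌉` are small enough for code
spaces of dimension `2^(l R'')`, because the logarithms of their sizes are of the order of `l²` and
of `l 2^(l R')`. -/
lemma eventually_card_nets_le {R' R'' : ℝ} (h0 : 0 ≤ R') (h : R' < R'') {δ : ℝ} (hδ : 0 < δ)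
    (hδ1 : δ ≤ 1) (K : ℕ) :
    ∀ᶠ l : ℕ in Filter.atTop, ∃ m₁ m₂ : ℕ, 0 < m₁ ∧ 0 < m₂ ∧ 2 * l * (K : ℝ) ^ l / δ ≤ m₁ ∧
      512 * (⌈(2 : ℝ) ^ ((l : ℝ) * R')⌉₊ : ℝ) ^ 2 / δ ≤ m₂ ∧
      ∀ k : ℕ, (2 : ℝ) ^ ((l : ℝ) * R'') ≤ k →
        (2 * m₁ + 1 : ℝ) ^ (2 * K * l) * (2 * m₂ + 1) ^ (2 * ⌈(2 : ℝ) ^ ((l : ℝ) * R')⌉₊) ≤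
          Real.exp (k * δ / 32) / 2 := by
  set B : ℝ := (2 : ℝ) ^ R' with hB
  set B' : ℝ := (2 : ℝ) ^ R'' with hB'
  have hB1 : 1 ≤ B := Real.one_le_rpow one_le_two h0
  have hB0 : 0 < B := by positivity
  have hB'0 : 0 < B' := by positivity
  have hBB' : B < B' := Real.rpow_lt_rpow_of_exponent_lt one_lt_two h
  set E₁ : ℝ := 9 / δ * (2 * (K + 1)) with hE₁
  set E₂ : ℝ := 4101 / δ * B ^ 2 with hE₂
  have h9 : 1 ≤ 9 / δ := by
    rw [le_div_iff₀ hδ]; linarith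
  have h4101 : 1 ≤ 4101 / δ := by
    rw [le_div_iff₀ hδ]; linarith
  have hK : (0 : ℝ) ≤ K := Nat.cast_nonneg K
  have hK1 : (1 : ℝ) ≤ 2 * (K + 1) := by linarith
  have hE₁1 : 1 ≤ E₁ := one_le_mul_of_one_le_of_one_le h9 hK1
  have hE₂1 : 1 ≤ E₂ := one_le_mul_of_one_le_of_one_le h4101 (one_le_pow₀ hB1)
  have hL₁ := Real.log_nonneg hE₁1
  have hL₂ := Real.log_nonneg hE₂1
  set c : ℝ := 2 * K * Real.log E₁ + 2 * Real.log E₂ with hc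
  have hc0 : 0 ≤ c := by positivity
  have hr : |B / B'| < 1 := by
    rw [abs_of_pos (by positivity), div_lt_one hB'0]
    exact hBB'
  have hlim := tendsto_pow_const_mul_const_pow_of_abs_lt_one 2 hr
  have hev := hlim.eventually_le_const (show 0 < δ / 32 / (8 * (c + 1)) by positivity)
  filter_upwards [hev, Filter.eventually_ge_atTop 1] with l hl hl1
  have hl1' : (1 : ℝ) ≤ l := by exact_mod_cast hl1
  rw [two_rpow_mul, ← hB, two_rpow_mul, ← hB']
  set D := ⌈B ^ l⌉₊ with hD
  have hBl : 1 ≤ B ^ l := one_le_pow₀ hB1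
  have hD1 : (1 : ℝ) ≤ D := hBl.trans (Nat.le_ceil _)
  have hD2 : (D : ℝ) ≤ 2 * B ^ l := by
    have := Nat.ceil_lt_add_one (zero_le_one.trans hBl)
    linarith
  obtain ⟨m₁, m₂, hm₁, hm₂, h₁, h₂, e₁, e₂⟩ := exists_resolutions hδ hδ1 hB1 K l hD2
  refine ⟨m₁, m₂, hm₁, hm₂, h₁, h₂, fun k hk => ?_⟩
  have f₁ := pow_le_exp_log_mul (by positivity) (by positivity) e₁ (2 * K * l)
  have f₂ := pow_le_exp_log_mul (by positivity) (by positivity) e₂ (2 * D)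
  refine (mul_le_mul f₁ f₂ (by positivity) (by positivity)).trans ?_
  rw [← Real.exp_add, le_div_iff₀ two_pos]
  have hexp : Real.exp ((2 * K * l : ℕ) * ((l + 1) * Real.log E₁) +
      (2 * D : ℕ) * ((l + 1) * Real.log E₂)) ≤ Real.exp (c * (l + 1) ^ 2 * D) := by
    refine Real.exp_le_exp.mpr ?_
    push_cast
    have g₀ : ((l : ℝ) + 1) ^ 2 ≤ (l + 1) ^ 2 * D := le_mul_of_one_le_right (by positivity) hD1
    have g₁ : 2 * K * l * ((l + 1) * Real.log E₁) ≤ 2 * K * Real.log E₁ * ((l + 1) ^ 2 * D) := by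
      calc 2 * K * l * ((l + 1) * Real.log E₁) = 2 * K * Real.log E₁ * (l * (l + 1)) := by ring
        _ ≤ 2 * K * Real.log E₁ * ((l + 1) ^ 2 * D) :=
          mul_le_mul_of_nonneg_left (by linarith [sq ((l : ℝ) + 1)]) (by positivity)
    have g₂ : 2 * D * ((l + 1) * Real.log E₂) ≤ 2 * Real.log E₂ * ((l + 1) ^ 2 * D) := by
      calc 2 * D * ((l + 1) * Real.log E₂) = 2 * Real.log E₂ * ((l + 1) * D) := by ring
        _ ≤ 2 * Real.log E₂ * ((l + 1) ^ 2 * D) := by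
          gcongr
          exact le_self_pow₀ (by linarith) two_ne_zero
    rw [hc]
    linarith
  have htwo : (2 : ℝ) ≤ Real.exp 1 := by linarith [Real.add_one_le_exp 1]
  calc _ ≤ Real.exp (c * (l + 1) ^ 2 * D) * Real.exp 1 :=
        mul_le_mul hexp htwo zero_le_two (Real.exp_pos _).le
    _ = Real.exp (c * (l + 1) ^ 2 * D + 1) := by rw [Real.exp_add]
    _ ≤ Real.exp (k * δ / 32) := by
      refine Real.exp_le_exp.mpr ?_
      have g₃ : 1 ≤ ((l : ℝ) + 1) ^ 2 * D :=
        one_le_mul_of_one_le_of_one_le (one_le_pow₀ (by linarith)) hD1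
      have g₄ : ((l : ℝ) + 1) ^ 2 * D ≤ 4 * l ^ 2 * (2 * B ^ l) := by
        refine mul_le_mul ?_ hD2 (by positivity) (by positivity)
        nlinarith
      have g₅ : (l : ℝ) ^ 2 * B ^ l * (8 * (c + 1)) ≤ δ / 32 * k := by
        rw [le_div_iff₀ (by positivity), div_pow] at hl
        calc (l : ℝ) ^ 2 * B ^ l * (8 * (c + 1))
            = (l : ℝ) ^ 2 * (B ^ l / B' ^ l) * (8 * (c + 1)) * B' ^ l := by
              field_simp
          _ ≤ δ / 32 * k := mul_le_mul hl hk (by positivity) (by positivity)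
      calc c * (l + 1) ^ 2 * D + 1 ≤ (c + 1) * (((l : ℝ) + 1) ^ 2 * D) := by linarith
        _ ≤ (c + 1) * (4 * l ^ 2 * (2 * B ^ l)) := by gcongr
        _ ≤ k * δ / 32 := by linarith

/-- A diagonal choice: performances that eventually exceed every number below their bound `1` admit
a choice that converges to `1`. -/
lemma exists_tendsto_one {X : ℕ → Type*} [∀ l, Nonempty (X l)] (f : ∀ l, X l → ℝ)
    (hf : ∀ l x, f l x ≤ 1) (h : ∀ δ > 0, ∀ᶠ l in Filter.atTop, ∃ x, 1 - δ ≤ f l x) :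
    ∃ x : ∀ l, X l, Filter.Tendsto (fun l => f l (x l)) Filter.atTop (nhds 1) := by
  have hbdd : ∀ l, BddAbove (Set.range (f l)) := fun l => ⟨1, by rintro _ ⟨x, rfl⟩; exact hf l x⟩
  have hx : ∀ l : ℕ, ∃ x, (⨆ x, f l x) - 1 / ((l : ℝ) + 1) < f l x := fun l =>
    exists_lt_of_lt_ciSup (sub_lt_self _ (by positivity))
  choose x hx using hx
  refine ⟨x, ?_⟩
  rw [Metric.tendsto_atTop']
  intro ε hε
  obtain ⟨n₁, hn₁⟩ := Filter.eventually_atTop.mp (h (ε / 2) (by positivity))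
  obtain ⟨n₂, hn₂⟩ := exists_nat_one_div_lt (show 0 < ε / 2 by positivity)
  refine ⟨max n₁ n₂, fun l hl => ?_⟩
  obtain ⟨y, hy⟩ := hn₁ l ((le_max_left _ _).trans hl.le)
  have h1 := le_ciSup (hbdd l) y
  have h2 : 1 / ((l : ℝ) + 1) ≤ 1 / (n₂ + 1) := by
    have : (n₂ : ℝ) ≤ l := by exact_mod_cast (le_max_right _ _).trans hl.le
    gcongr
  rw [Real.dist_eq, abs_lt]
  constructor <;> linarith [hx l, hf l (x l)]

end Asymptotics

/-! ### Comparison of the achievable rates -/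

section Rates

variable {S a b : Type*} [Fintype a] [DecidableEq a] [Fintype b] [DecidableEq b]
  {N : S → Channel a b}

lemma RateAtLeast.eventually_rpow_le {k : ℕ → ℕ} {R : ℝ≥0} (h : RateAtLeast k R)
    (hk : ∀ l, 0 < k l) {R'' : ℝ} (hR : R'' < R) :
    ∀ᶠ l : ℕ in Filter.atTop, (2 : ℝ) ^ ((l : ℝ) * R'') ≤ k l := by
  have h1 := Filter.eventually_lt_of_lt_liminf ((EReal.coe_lt_coe_iff.mpr hR).trans_le h)
  filter_upwards [h1, Filter.eventually_ge_atTop 1] with l hl hl1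
  have hl0 : (0 : ℝ) < l := by exact_mod_cast hl1
  rw [EReal.coe_lt_coe_iff, one_div, lt_inv_mul_iff₀ hl0] at hl
  exact ((Real.le_logb_iff_rpow_le one_lt_two (by exact_mod_cast hk l)).mp hl.le)

lemma rateAtLeast_of_eventually {k : ℕ → ℕ} {R : ℝ≥0}
    (h : ∀ᶠ l : ℕ in Filter.atTop, (2 : ℝ) ^ ((l : ℝ) * R) ≤ k l) : RateAtLeast k R := by
  refine Filter.le_liminf_of_le (by isBoundedDefault) ?_
  filter_upwards [h, Filter.eventually_ge_atTop 1] with l hl hl1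
  have hl0 : (0 : ℝ) < l := by exact_mod_cast hl1
  have hk : (0 : ℝ) < k l := lt_of_lt_of_le (by positivity) hl
  rw [EReal.coe_le_coe_iff, one_div, le_inv_mul_iff₀ hl0]
  exact (Real.le_logb_iff_rpow_le one_lt_two hk).mpr hl

/-- Every rate below an achievable entanglement transmission rate is an achievable strong subspace
transmission rate, with deterministic codes wherever the given codes are deterministic. -/
lemma exists_strongCodes_of_entCodes [Nonempty S] {k : ℕ → ℕ} {C : ∀ l, EntCode N l (k l)}
    {R R' : ℝ≥0} (hR : R' < R) (hk : RateAtLeast k R)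
    (hC : Filter.Tendsto (fun l => (C l).performance) Filter.atTop (nhds 1)) :
    ∃ (D : ℕ → ℕ) (C' : ∀ l, StrongCode N l (D l)), RateAtLeast D R' ∧
      Filter.Tendsto (fun l => (C' l).performance) Filter.atTop (nhds 1) ∧
      ∀ l, (C l).IsDeterministic → (C' l).toEntCode.IsDeterministic := by
  classical
  let X : ∀ l : ℕ, ℕ → Type _ := fun l D =>
    {C' : StrongCode N l D // (C l).IsDeterministic → C'.toEntCode.IsDeterministic}
  have hX1 : ∀ l, Nonempty (X l 1) := fun l => by
    obtain ⟨C', hC'⟩ := (C l).exists_strongCode_one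
    exact ⟨⟨C', hC'⟩⟩
  have hmid : (((R : ℝ) + R') / 2) < R := by
    have : (R' : ℝ) < R := hR
    linarith
  have hmid' : (R' : ℝ) < ((R : ℝ) + R') / 2 := by
    have : (R' : ℝ) < R := hR
    linarith
  have key : ∀ δ > 0, ∀ᶠ l : ℕ in Filter.atTop,
      ∃ x : X l ⌈(2 : ℝ) ^ ((l : ℝ) * R')⌉₊, 1 - δ ≤ x.1.performance := by
    intro δ hδ
    set δ' := min (δ / 3) 1 with hδ'
    have hδ'0 : 0 < δ' := lt_min (by positivity) one_pos
    have hperf := hC.eventually_const_le (show 1 - δ' / 16 < 1 by linarith)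
    filter_upwards [hperf, hk.eventually_rpow_le (fun l => (C l).k_pos) hmid,
      eventually_card_nets_le R'.2 hmid' hδ'0 (min_le_right _ _)
        ((Fintype.card a * Fintype.card b) ^ 2)] with l h1 h2 ⟨m₁, m₂, hm₁, hm₂, h3, h4, h5⟩
    obtain ⟨C', hC'det, hC'⟩ := (C l).exists_strongCode hδ'0 (min_le_right _ _) h1
      (Nat.ceil_pos.mpr (by positivity)) hm₁ hm₂ h3 h4 (h5 _ h2)
    have h6 : 1 - δ ≤ C'.performance := by linarith [min_le_left (δ / 3) 1]
    exact ⟨⟨C', hC'det⟩, h6⟩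
  -- for the finitely many block lengths without a code of the desired dimension, dimension one
  let D : ℕ → ℕ := fun l =>
    if Nonempty (X l ⌈(2 : ℝ) ^ ((l : ℝ) * R')⌉₊) then ⌈(2 : ℝ) ^ ((l : ℝ) * R')⌉₊ else 1
  have hDev : ∀ᶠ l in Filter.atTop, D l = ⌈(2 : ℝ) ^ ((l : ℝ) * R')⌉₊ := by
    filter_upwards [key 1 one_pos] with l ⟨x, _⟩
    exact if_pos ⟨x⟩
  have hne : ∀ l, Nonempty (X l (D l)) := by
    intro l
    by_cases h : Nonempty (X l ⌈(2 : ℝ) ^ ((l : ℝ) * R')⌉₊)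
    · simp only [D, if_pos h]
      exact h
    · simp only [D, if_neg h]
      exact hX1 l
  obtain ⟨x, hx⟩ := exists_tendsto_one (fun l (x : X l (D l)) => x.1.performance)
    (fun l x => x.1.performance_le_one) (fun δ hδ => by
      filter_upwards [key δ hδ, hDev] with l hl hD
      rw [hD]
      exact hl)
  refine ⟨D, fun l => (x l).1, rateAtLeast_of_eventually ?_, hx, fun l => (x l).2⟩
  filter_upwards [hDev] with l hl
  rw [hl]
  exact Nat.le_ceil _

lemma iSup_le_iSup_of_lt {P Q : ℝ≥0 → Prop} (h : ∀ R R', R' < R → P R → Q R') :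
    ⨆ (R : ℝ≥0) (_ : P R), (R : ℝ≥0∞) ≤ ⨆ (R : ℝ≥0) (_ : Q R), (R : ℝ≥0∞) := by
  refine iSup₂_le fun R hR => ENNReal.le_of_forall_nnreal_lt fun R' hR' => ?_
  exact le_iSup₂_of_le R' (h R R' (ENNReal.coe_lt_coe.mp hR') hR) le_rfl

end Rates

end AVQC

theorem mainTheorem2 {S a b : Type*} [Nonempty S] [Fintype a] [DecidableEq a]
    [Fintype b] [DecidableEq b] (N : S → AVQC.Channel a b) :
    AVQC.strongCapacity N = AVQC.entCapacity N ∧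
      AVQC.strongDetCapacity N = AVQC.entDetCapacity N := by
  constructor
  · refine le_antisymm ?_ ?_
    · refine iSup₂_mono' fun R ⟨k, C, hk, hC⟩ =>
        ⟨R, ⟨k, fun l => (C l).toEntCode, hk, AVQC.tendsto_performance_toEntCode hC⟩, le_rfl⟩
    · refine AVQC.iSup_le_iSup_of_lt fun R R' hR ⟨k, C, hk, hC⟩ => ?_
      obtain ⟨D, C', hD, hC', -⟩ := AVQC.exists_strongCodes_of_entCodes hR hk hC
      exact ⟨D, C', hD, hC'⟩
  · refine le_antisymm ?_ ?_
    · refine iSup₂_mono' fun R ⟨k, C, hdet, hk, hC⟩ =>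
        ⟨R, ⟨k, fun l => (C l).toEntCode, hdet, hk, AVQC.tendsto_performance_toEntCode hC⟩, le_rfl⟩
    · refine AVQC.iSup_le_iSup_of_lt fun R R' hR ⟨k, C, hdet, hk, hC⟩ => ?_
      obtain ⟨D, C', hD, hC', hdet'⟩ := AVQC.exists_strongCodes_of_entCodes hR hk hC
      exact ⟨D, C', fun l => hdet' l (hdet l), hD, hC'⟩
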